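/- **Setting.** Let $\mathbf k$ be a field of characteristic $0$, $m\ge 0$, $\mathbb K=\mathbf k(x_1,\dots,x_m)$, $\hat{\mathbb K}=\mathbb K(x_0)$, and write $n=x_0$. Let $\mathbb A=\hat{\mathbb K}\langle\partial_0,\dots,\partial_m\rangle$ be an Ore algebra: a left $\hat{\mathbb K}$-vector space with basis the monomials in the $\partial_i$, which commute with each other, with $\partial_iR=\sigma_i(R)\partial_i+\delta_i(R)$ for $R\in\hat{\mathbb K}$, where $\sigma_i$ is a ring endomorphism of $\hat{\mathbb K}$ and $\delta_i$ a $\sigma_i$-derivation. Assume that $\partial_0=S_n$ is the shift $x_0\mapsto x_0+1$ ($\delta_0=0$) and that $\sigma_i,\delta_i$ map $\mathbb K$ to itself for $i\ge1$, so that $\mathbb K\langle\partial_1,\dots,\partial_m\rangle$ is an Ore algebra contained in $\mathbb A$ (for instance each $\partial_i$, $i\ge 1$, is the shift $x_i\mapsto x_i+1$ or the derivation $d/dx_i$). Put $\Delta_n=S_n-1$. A left ideal of an Ore algebra is *D-finite* if the quotient is finite-dimensional over the coefficient field. For a left ideal $\mathcal I$ of $\mathbb A$ let $\mathcal T_{\mathcal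 I}=(\mathcal I+\Delta_n\mathbb A)\cap\mathbb K\langle\partial_1,\dots,\partial_m\rangle$. For $P=\sum_i a_iS_n^i\in\hat{\mathbb K}\langle S_n\rangle$ and $R\in\hat{\mathbb K}$ let $P^*(R)=\sum_i a_i(n-i)R(n-i)$. Let $\mathcal I$ be a D-finite left ideal of $\mathbb A$ given by finitely many generators, $r=\dim_{\hat{\mathbb K}}\mathbb A/\mathcal I$, and let $\gamma\in\mathbb A/\mathcal I$ be a cyclic vector for $S_n$, i.e. $\gamma,S_n\gamma,\dots,S_n^{r-1}\gamma$ is a basis of $\mathbb A/\mathcal I$ over $\hat{\mathbb K}$. Let $L\in\hat{\mathbb K}\langle S_n\rangle$ be a nonzero operator of minimal order with $L\gamma=0$, let $A_1,B_1,\dots,B_m\in\hat{\mathbb K}\langle S_n\rangle$ satisfy $A_1\gamma=1$ and $B_i\gamma=\partial_i\gamma$ in $\mathbb A/\mathcal I$, and put $\varphi_i(R)=B_i^*(\sigma_i(R))+\delta_i(R)$. Let $[\cdot]:\hat{\mathbb K}\to\hat{\mathbb K}$ be a canonical form associated to $L^*$: a $\mathbb K$-linear map with $[L^*(R)]=0$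 and $R-[R]\in L^*(\hat{\mathbb K})$ for all $R\in\hat{\mathbb K}$. **Algorithm.** Start with the list $\mathcal L=[1]$ of monomials in $\partial_1,\dots,\partial_m$ and with $\mathcal G,\mathcal Q,\mathcal R$ empty. While $\mathcal L$ is not empty, remove its first element $\partial^\alpha$. If $\partial^\alpha$ is a multiple of an element of $\mathcal R$, do nothing more in this pass. Otherwise let $R_0=[A_1^*(1)]$ if $\alpha=0$, and if $\alpha\ne0$ take $j$ and $\partial^\beta\in\mathcal Q$ with $\partial^\alpha=\partial_j\partial^\beta$ and let $R_\alpha=[\varphi_j(R_\beta)]$. If $R_\alpha=\sum_{\partial^\beta\in\mathcal Q}\lambda_\beta R_\beta$ for some $\lambda_\beta\in\mathbb K$, add $\partial^\alpha-\sum_\beta\lambda_\beta\partial^\beta$ to $\mathcal G$ and $\partial^\alpha$ to $\mathcal R$. If there is no such relation, add $\partial^\alpha$ to $\mathcal Q$ and append to $\mathcal L$ those of $\partial_1\partial^\alpha,\dots,\partial_m\partial^\alpha$, in this order, that $\mathcal L$ does not contain already. When $\mathcal L$ is empty, return $\mathcal G$. **Theorem.** The algorithm terminates if and only if $\mathcal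 T_{\mathcal I}$ is D-finite (whatever choices of $j$ are made: if $\mathcal T_{\mathcal I}$ is D-finite every run stops and returns a result, and otherwise no run does). When it terminates, its output $\mathcal G$ is a Gröbner basis of the left ideal $\mathcal T_{\mathcal I}$ of $\mathbb K\langle\partial_1,\dots,\partial_m\rangle$ for the grevlex order with $\partial_1<\dots<\partial_m$: a finite subset of $\mathcal T_{\mathcal I}$ such that the leading monomial of every nonzero element of $\mathcal T_{\mathcal I}$ is a multiple of the leading monomial of an element of $\mathcal G$. -/

import Mathlib

noncomputable section

namespace CreativeTelescoping

/-! ### Ore algebras -/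

/-- Commutation data for an Ore algebra over `F` with generators `∂ i`, `i : ι`: each `σ i` is a ring
morphism, each `δ i` is a `σ i`-derivation. The last three fields are the compatibility that the
relations `∂ i R = σ i (R) ∂ i + δ i (R)` need in order to be consistent with `∂ i ∂ j = ∂ j ∂ i`. -/
structure OreData (F : Type*) [CommRing F] (ι : Type*) where
  σ : ι → F →+* F
  δ : ι → F →+ F
  δ_mul : ∀ i a b, δ i (a * b) = σ i a * δ i b + δ i a * b
  σ_comm : ∀ i j a, σ i (σ j a) = σ j (σ i a)
  δ_comm : ∀ i j a, δ i (δ j a) = δ j (δ i a)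
  σ_δ_comm : ∀ i j, i ≠ j → ∀ a, σ i (δ j a) = δ j (σ i a)

/-- The Ore algebra `F⟨∂ i : i ∈ ι⟩`: the left `F`-module of polynomials `∑ c_α ∂^α` with
coefficients written on the left, stored as the finitely supported family of the `c_α`. Its product
is the one ruled by `∂ i R = σ i (R) ∂ i + δ i (R)` and `∂ i ∂ j = ∂ j ∂ i`. -/
def OreAlgebra {F : Type*} [CommRing F] {ι : Type*} (_D : OreData F ι) : Type _ := (ι →₀ ℕ) →₀ F

namespace OreAlgebra

variable {F : Type*} [CommRing F] {ι : Type*} {D : OreData F ι}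

instance : AddCommGroup (OreAlgebra D) := inferInstanceAs (AddCommGroup ((ι →₀ ℕ) →₀ F))

instance : Module F (OreAlgebra D) := inferInstanceAs (Module F ((ι →₀ ℕ) →₀ F))

/-- The coefficient `c_α` of `∂^α`. -/
def coeff (p : OreAlgebra D) (α : ι →₀ ℕ) : F := Finsupp.toFun p α

/-- The (finite) set of exponents `α` with `c_α ≠ 0`. -/
def support (p : OreAlgebra D) : Finset (ι →₀ ℕ) := Finsupp.support p

variable (D) in
/-- The element `c ∂^α`. -/
def monomial (α : ι →₀ ℕ) : F →+ OreAlgebra D := Finsupp.singleAddHom α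

theorem addHom_ext {M : Type*} [AddZeroClass M] {f g : OreAlgebra D →+ M}
    (h : ∀ α c, f (monomial D α c) = g (monomial D α c)) : f = g :=
  Finsupp.addHom_ext h

theorem smul_monomial (c d : F) (α : ι →₀ ℕ) :
    c • monomial D α d = monomial D α (c * d) :=
  Finsupp.smul_single' c α d

/-- The unique additive map with prescribed values on the `c ∂^α`. -/
def liftAdd {M : Type*} [AddCommMonoid M] (f : (ι →₀ ℕ) → F →+ M) : OreAlgebra D →+ M :=
  Finsupp.liftAddHom f

@[simp]
theorem liftAdd_monomial {M : Type*} [AddCommMonoid M] (f : (ι →₀ ℕ) → F →+ M)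
    (α : ι →₀ ℕ) (c : F) : liftAdd (D := D) f (monomial D α c) = f α c :=
  Finsupp.liftAddHom_apply_single f α c

variable (D) in
/-- Left multiplication by `∂ i`: `c ∂^α ↦ σ i (c) ∂^(α + e i) + δ i (c) ∂^α`. -/
def lmulVar (i : ι) : AddMonoid.End (OreAlgebra D) :=
  liftAdd fun α =>
    (monomial D (α + Finsupp.single i 1)).comp (D.σ i).toAddMonoidHom + (monomial D α).comp (D.δ i)

theorem lmulVar_monomial (i : ι) (α : ι →₀ ℕ) (c : F) :
    lmulVar D i (monomial D α c) =
      monomial D (α + Finsupp.single i 1) (D.σ i c) + monomial D α (D.δ i c) :=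
  liftAdd_monomial _ _ _

theorem lmulVar_comm (i j : ι) : lmulVar D i * lmulVar D j = lmulVar D j * lmulVar D i := by
  by_cases hij : i = j
  · rw [hij]
  refine addHom_ext fun α c => ?_
  change lmulVar D i (lmulVar D j _) = lmulVar D j (lmulVar D i _)
  simp only [lmulVar_monomial, map_add, D.σ_comm i j, D.δ_comm i j, D.σ_δ_comm i j hij,
    D.σ_δ_comm j i (Ne.symm hij), add_right_comm α (Finsupp.single j 1)]
  abel

theorem lmulVar_smul (i : ι) (c : F) (p : OreAlgebra D) :
    lmulVar D i (c • p) = D.σ i c • lmulVar D i p + D.δ i c • p := by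
  have h : (lmulVar D i).comp (DistribSMul.toAddMonoidHom (OreAlgebra D) c) =
      (DistribSMul.toAddMonoidHom (OreAlgebra D) (D.σ i c)).comp (lmulVar D i) +
        DistribSMul.toAddMonoidHom (OreAlgebra D) (D.δ i c) := by
    refine addHom_ext fun α d => ?_
    change lmulVar D i (c • monomial D α d) =
      D.σ i c • lmulVar D i (monomial D α d) + D.δ i c • monomial D α d
    simp only [smul_monomial, lmulVar_monomial, smul_add, D.δ_mul, map_add, map_mul]
    abel
  exact DFunLike.congr_fun h p

variable (D) in
abbrev OpMonoid : Submonoid (AddMonoid.End (OreAlgebra D)) :=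
  Submonoid.closure (Set.range (lmulVar D))

instance : IsMulCommutative (OpMonoid D) :=
  Submonoid.isMulCommutative_closure _ (by
    rintro _ ⟨i, rfl⟩ _ ⟨j, rfl⟩
    exact lmulVar_comm i j)

instance : CommMonoid (OpMonoid D) :=
  { (inferInstance : Monoid (OpMonoid D)) with mul_comm := mul_comm' }

variable (D) in
/-- Left multiplication by `∂^α`: the product of the commuting maps `(lmulVar i) ^ (α i)`. -/
def lmulPow (α : ι →₀ ℕ) : AddMonoid.End (OreAlgebra D) :=
  ((α.prod fun i n =>
    (⟨lmulVar D i, Submonoid.subset_closure ⟨i, rfl⟩⟩ : OpMonoid D) ^ n : OpMonoid D) :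
    AddMonoid.End (OreAlgebra D))

theorem lmulPow_zero : lmulPow D 0 = 1 := by
  simp [lmulPow]

theorem lmulPow_add (α β : ι →₀ ℕ) : lmulPow D (α + β) = lmulPow D α * lmulPow D β := by
  classical
  unfold lmulPow
  rw [Finsupp.prod_add_index' (fun i => pow_zero _) (fun i a b => pow_add _ a b)]
  rfl

theorem lmulPow_single (i : ι) : lmulPow D (Finsupp.single i 1) = lmulVar D i := by
  simp [lmulPow, Finsupp.prod_single_index]

variable (D) in
/-- Left multiplication by an arbitrary element: `∑ c_α ∂^α` acts by `q ↦ ∑ c_α • (∂^α q)`. -/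
def lmul : OreAlgebra D →+ AddMonoid.End (OreAlgebra D) :=
  liftAdd fun α =>
    { toFun := fun c => (DistribSMul.toAddMonoidHom (OreAlgebra D) c).comp (lmulPow D α)
      map_zero' := by
        ext q : 1
        exact zero_smul F (lmulPow D α q)
      map_add' := fun a b => by
        ext q : 1
        exact add_smul a b (lmulPow D α q) }

theorem lmul_monomial (α : ι →₀ ℕ) (c : F) (q : OreAlgebra D) :
    lmul D (monomial D α c) q = c • lmulPow D α q := by
  rw [lmul, liftAdd_monomial]
  rfl

theorem lmul_add_left (p q r : OreAlgebra D) :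
    lmul D (p + q) r = lmul D p r + lmul D q r := by
  rw [map_add]; rfl

theorem lmul_zero_left (r : OreAlgebra D) : lmul D 0 r = 0 := by
  rw [map_zero]; rfl

instance : Mul (OreAlgebra D) := ⟨fun p q => lmul D p q⟩

instance : One (OreAlgebra D) := ⟨monomial D 0 1⟩

theorem mul_def (p q : OreAlgebra D) : p * q = lmul D p q := rfl

theorem one_def : (1 : OreAlgebra D) = monomial D 0 1 := rfl

theorem lmul_smul (c : F) (p q : OreAlgebra D) : lmul D (c • p) q = c • lmul D p q := by
  have h : ((AddMonoidHom.eval q).comp (lmul D)).comp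
      (DistribSMul.toAddMonoidHom (OreAlgebra D) c) =
      (DistribSMul.toAddMonoidHom (OreAlgebra D) c).comp
        ((AddMonoidHom.eval q).comp (lmul D)) := by
    refine addHom_ext fun α d => ?_
    change lmul D (c • monomial D α d) q = c • lmul D (monomial D α d) q
    rw [smul_monomial, lmul_monomial, lmul_monomial, mul_smul]
  exact DFunLike.congr_fun h p

theorem lmul_lmulVar (i : ι) (p q : OreAlgebra D) :
    lmul D (lmulVar D i p) q = lmulVar D i (lmul D p q) := by
  have h : ((AddMonoidHom.eval q).comp (lmul D)).comp (lmulVar D i) =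
      (lmulVar D i).comp ((AddMonoidHom.eval q).comp (lmul D)) := by
    refine addHom_ext fun α d => ?_
    change lmul D (lmulVar D i (monomial D α d)) q = lmulVar D i (lmul D (monomial D α d) q)
    rw [lmulVar_monomial, lmul_monomial, lmulVar_smul, lmul_add_left,
      lmul_monomial, lmul_monomial, add_comm α, lmulPow_add, lmulPow_single]
    rfl
  exact DFunLike.congr_fun h p

theorem lmul_lmulPow (α : ι →₀ ℕ) (p q : OreAlgebra D) :
    lmul D (lmulPow D α p) q = lmulPow D α (lmul D p q) := by
  classical
  induction α using Finsupp.induction_linear generalizing p with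
  | zero => rw [lmulPow_zero]; rfl
  | add α β hα hβ =>
    rw [lmulPow_add]
    change lmul D (lmulPow D α (lmulPow D β p)) q = lmulPow D α (lmulPow D β (lmul D p q))
    rw [hα, hβ]
  | single i n =>
    induction n generalizing p with
    | zero => rw [Finsupp.single_zero, lmulPow_zero]; rfl
    | succ n ih =>
      rw [Finsupp.single_add, lmulPow_add, lmulPow_single]
      change lmul D (lmulPow D _ (lmulVar D i p)) q = lmulPow D _ (lmulVar D i (lmul D p q))
      rw [ih, lmul_lmulVar]

theorem lmul_lmul (p q r : OreAlgebra D) : lmul D (lmul D p q) r = lmul D p (lmul D q r) := by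
  have h : ((AddMonoidHom.eval r).comp (lmul D)).comp ((AddMonoidHom.eval q).comp (lmul D)) =
      (AddMonoidHom.eval (lmul D q r)).comp (lmul D) := by
    refine addHom_ext fun α d => ?_
    change lmul D (lmul D (monomial D α d) q) r = lmul D (monomial D α d) (lmul D q r)
    rw [lmul_monomial, lmul_monomial, lmul_smul, lmul_lmulPow]
  exact DFunLike.congr_fun h p

theorem lmulPow_monomial_one (α β : ι →₀ ℕ) :
    lmulPow D α (monomial D β 1) = monomial D (α + β) 1 := by
  classical
  have hv : ∀ i (β : ι →₀ ℕ), lmulVar D i (monomial D β 1) =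
      monomial D (Finsupp.single i 1 + β) 1 := by
    intro i β
    have h0 : D.δ i 1 = 0 := by simpa using D.δ_mul i 1 1
    rw [lmulVar_monomial, h0, map_one, map_zero, add_zero, add_comm]
  induction α using Finsupp.induction_linear generalizing β with
  | zero => rw [lmulPow_zero, zero_add]; rfl
  | add α α' hα hβ =>
    rw [lmulPow_add]
    change lmulPow D α (lmulPow D α' _) = _
    rw [hβ, hα, add_assoc]
  | single i n =>
    induction n generalizing β with
    | zero => rw [Finsupp.single_zero, lmulPow_zero, zero_add]; rfl
    | succ n ih =>
      rw [Finsupp.single_add, lmulPow_add, lmulPow_single]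
      change lmulPow D _ (lmulVar D i _) = _
      rw [hv, ih, add_assoc]

theorem lmul_one_right (p : OreAlgebra D) : lmul D p (monomial D 0 1) = p := by
  have h : (AddMonoidHom.eval (monomial D 0 1)).comp (lmul D) = AddMonoidHom.id _ := by
    refine addHom_ext fun α d => ?_
    change lmul D (monomial D α d) (monomial D 0 1) = monomial D α d
    rw [lmul_monomial, lmulPow_monomial_one, add_zero, smul_monomial, mul_one]
  exact DFunLike.congr_fun h p

instance : Ring (OreAlgebra D) where
  __ := (inferInstance : AddCommGroup (OreAlgebra D))
  mul_assoc p q r := lmul_lmul p q r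
  one_mul p := by
    rw [mul_def, one_def, lmul_monomial, lmulPow_zero, one_smul]; rfl
  mul_one p := lmul_one_right p
  left_distrib p q r := map_add (lmul D p) q r
  right_distrib p q r := lmul_add_left p q r
  zero_mul p := lmul_zero_left p
  mul_zero p := map_zero (lmul D p)

instance : IsScalarTower F (OreAlgebra D) (OreAlgebra D) :=
  ⟨fun c p q => lmul_smul c p q⟩

variable (D) in
/-- The generator `∂ i`. -/
def var (i : ι) : OreAlgebra D := monomial D (Finsupp.single i 1) 1

theorem var_mul (i : ι) (p : OreAlgebra D) : var D i * p = lmulVar D i p := by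
  rw [var, mul_def, lmul_monomial, one_smul, lmulPow_single]

/-- The defining commutation rule `∂ i R = σ i (R) ∂ i + δ i (R)`. -/
theorem var_mul_coeff (i : ι) (R : F) :
    var D i * monomial D 0 R = monomial D 0 (D.σ i R) * var D i + monomial D 0 (D.δ i R) := by
  rw [var_mul, lmulVar_monomial, mul_def, lmul_monomial, lmulPow_zero, zero_add, var]
  change _ = D.σ i R • monomial D (Finsupp.single i 1) 1 + _
  rw [smul_monomial, mul_one]

end OreAlgebra

open OreAlgebra

/-- A left ideal `I` of the Ore algebra is D-finite when the quotient is a finite-dimensional vector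
space over the coefficient field. -/
def IsDFinite {F : Type*} [Field F] {ι : Type*} {D : OreData F ι}
    (I : Submodule (OreAlgebra D) (OreAlgebra D)) : Prop :=
  Module.Finite F (OreAlgebra D ⧸ I)

/-! ### Fields of rational functions, shifts and partial derivatives -/

/-- The field of rational functions over `k` in `n` variables `X 0, …, X (n - 1)`. -/
abbrev RatField (k : Type*) [Field k] (n : ℕ) : Type _ := FractionRing (MvPolynomial (Fin n) k)

section RatField

variable {k : Type*} [Field k] {n : ℕ}

/-- The substitution `X i ↦ X i + c` on polynomials. -/
def polyTranslate (i : Fin n) (c : k) : MvPolynomial (Fin n) k →ₐ[k] MvPolynomial (Fin n) k :=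
  MvPolynomial.aeval fun j => MvPolynomial.X j + if j = i then MvPolynomial.C c else 0

theorem polyTranslate_X (i : Fin n) (c : k) (j : Fin n) :
    polyTranslate i c (MvPolynomial.X j) =
      MvPolynomial.X j + if j = i then MvPolynomial.C c else 0 := by
  simp [polyTranslate]

theorem polyTranslate_injective (i : Fin n) (c : k) :
    Function.Injective (polyTranslate (n := n) i c) := by
  have h : (polyTranslate i (-c)).comp (polyTranslate i c) = AlgHom.id k _ := by
    refine MvPolynomial.algHom_ext fun j => ?_
    rw [AlgHom.comp_apply, polyTranslate_X, map_add, polyTranslate_X]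
    split_ifs <;> simp [MvPolynomial.algHom_C]
  exact Function.LeftInverse.injective (g := polyTranslate i (-c)) fun p => DFunLike.congr_fun h p

/-- The substitution `X i ↦ X i + c` on rational functions. -/
def translate (i : Fin n) (c : k) : RatField k n →+* RatField k n :=
  IsFractionRing.map (A := MvPolynomial (Fin n) k) (B := MvPolynomial (Fin n) k)
    (j := (polyTranslate i c).toRingHom) (polyTranslate_injective i c)

theorem translate_algebraMap (i : Fin n) (c : k) (p : MvPolynomial (Fin n) k) :
    translate i c (algebraMap _ (RatField k n) p) = algebraMap _ _ (polyTranslate i c p) := by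
  simp [translate, IsFractionRing.map]

/-- The ring morphism `R ↦ R + R' ε` to the dual numbers, `R'` being the partial derivative with
respect to `X i`; on polynomials it is `MvPolynomial.pderiv i`. -/
def dualHom (i : Fin n) : RatField k n →+* TrivSqZeroExt (RatField k n) (RatField k n) :=
  IsLocalization.lift (M := nonZeroDivisors (MvPolynomial (Fin n) k))
    (g :=
      { toFun := fun p =>
          TrivSqZeroExt.inl (algebraMap _ (RatField k n) p) +
            TrivSqZeroExt.inr (algebraMap _ (RatField k n) (MvPolynomial.pderiv i p))
        map_one' := by ext <;> simp
        map_mul' := fun p q => by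
          ext <;> simp [Derivation.leibniz, -DualNumber.inr_eq_smul_eps, mul_comm]
        map_zero' := by ext <;> simp
        map_add' := fun p q => by ext <;> simp [-DualNumber.inr_eq_smul_eps] })
    (fun y => by
      rw [TrivSqZeroExt.isUnit_iff_isUnit_fst]
      simp)

theorem dualHom_algebraMap (i : Fin n) (p : MvPolynomial (Fin n) k) :
    dualHom i (algebraMap _ (RatField k n) p) =
      TrivSqZeroExt.inl (algebraMap _ (RatField k n) p) +
        TrivSqZeroExt.inr (algebraMap _ (RatField k n) (MvPolynomial.pderiv i p)) :=
  IsLocalization.lift_eq _ _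

theorem dualHom_fst (i : Fin n) (R : RatField k n) : (dualHom i R).fst = R := by
  have h : (TrivSqZeroExt.fstHom (RatField k n) (RatField k n) (RatField k n)).toRingHom.comp
      (dualHom i) = RingHom.id _ := by
    refine IsLocalization.ringHom_ext (nonZeroDivisors (MvPolynomial (Fin n) k)) ?_
    refine RingHom.ext fun p => ?_
    change (dualHom i (algebraMap _ (RatField k n) p)).fst = algebraMap _ _ p
    simp [dualHom_algebraMap]
  exact DFunLike.congr_fun h R

/-- The partial derivative `d / d(X i)` on rational functions. -/
def partialDeriv (i : Fin n) : RatField k n →+ RatField k n where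
  toFun R := (dualHom i R).snd
  map_zero' := by simp
  map_add' R S := by simp

theorem partialDeriv_algebraMap (i : Fin n) (p : MvPolynomial (Fin n) k) :
    partialDeriv i (algebraMap _ (RatField k n) p) =
      algebraMap _ (RatField k n) (MvPolynomial.pderiv i p) := by
  change (dualHom i _).snd = _
  simp [dualHom_algebraMap, -DualNumber.inr_eq_smul_eps]

theorem partialDeriv_mul (i : Fin n) (R S : RatField k n) :
    partialDeriv i (R * S) = R * partialDeriv i S + partialDeriv i R * S := by
  change (dualHom i (R * S)).snd = R * (dualHom i S).snd + (dualHom i R).snd * S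
  rw [map_mul, TrivSqZeroExt.snd_mul, dualHom_fst, dualHom_fst]
  simp [mul_comm]

/-- A derivation along a ring morphism that vanishes on polynomials vanishes. -/
theorem eq_zero_of_twisted_derivation {E : Type*} [Field E] (τ : RatField k n →+* E)
    (d : RatField k n →+ E) (hd : ∀ a b, d (a * b) = τ a * d b + d a * τ b)
    (h0 : ∀ p : MvPolynomial (Fin n) k, d (algebraMap _ _ p) = 0) : d = 0 := by
  ext R
  obtain ⟨p, q, hq, rfl⟩ := IsFractionRing.div_surjective (A := MvPolynomial (Fin n) k) R
  have hq0 : algebraMap _ (RatField k n) q ≠ 0 :=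
    IsFractionRing.to_map_ne_zero_of_mem_nonZeroDivisors hq
  have h := hd (algebraMap _ _ p / algebraMap _ _ q) (algebraMap _ (RatField k n) q)
  rw [div_mul_cancel₀ _ hq0, h0, h0, mul_zero, zero_add] at h
  rcases mul_eq_zero.1 h.symm with h | h
  · exact h
  · exact absurd ((map_eq_zero τ).1 h) hq0

/-- The inclusion of `K = k(x_1, …, x_m)` in `K(x_0) = k(x_0, …, x_m)`. The variables of `K`
are numbered from `0` in `RatField k m` and are sent to the variables with index `≥ 1`. -/
def emb : RatField k n →+* RatField k (n + 1) :=
  IsFractionRing.map (A := MvPolynomial (Fin n) k) (B := MvPolynomial (Fin (n + 1)) k)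
    (j := (MvPolynomial.rename Fin.succ).toRingHom)
    (MvPolynomial.rename_injective _ (Fin.succ_injective n))

theorem emb_algebraMap (p : MvPolynomial (Fin n) k) :
    emb (algebraMap _ (RatField k n) p) =
      algebraMap _ (RatField k (n + 1)) (MvPolynomial.rename Fin.succ p) := by
  simp [emb, IsFractionRing.map]

/-- `K` consists of constants for the shift of `x_0`. -/
theorem translate_zero_emb (c : k) (R : RatField k n) : translate 0 c (emb R) = emb R := by
  have h : (translate 0 c).comp (emb (k := k) (n := n)) = emb := by
    refine IsLocalization.ringHom_ext (nonZeroDivisors (MvPolynomial (Fin n) k)) ?_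
    refine RingHom.ext fun p => ?_
    simp only [RingHom.comp_apply, emb_algebraMap, translate_algebraMap]
    refine congrArg (algebraMap _ _) ?_
    have h2 : (polyTranslate 0 c).comp (MvPolynomial.rename Fin.succ) =
        MvPolynomial.rename (R := k) (Fin.succ (n := n)) := by
      refine MvPolynomial.algHom_ext fun j => ?_
      simp [polyTranslate_X, Fin.succ_ne_zero]
    exact DFunLike.congr_fun h2 p
  exact DFunLike.congr_fun h R

end RatField

/-! ### The typical Ore operators: shifts and derivations -/

section Commutation

variable {k : Type*} [Field k] {n : ℕ}

theorem translate_comm (i j : Fin n) (a : RatField k n) :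
    translate i (1 : k) (translate j 1 a) = translate j 1 (translate i 1 a) := by
  have h : (translate i (1 : k)).comp (translate j 1) =
      (translate j 1).comp (translate i 1) := by
    refine IsLocalization.ringHom_ext (nonZeroDivisors (MvPolynomial (Fin n) k)) ?_
    refine RingHom.ext fun p => ?_
    simp only [RingHom.comp_apply, translate_algebraMap]
    refine congrArg (algebraMap _ _) ?_
    have h2 : (polyTranslate i (1 : k)).comp (polyTranslate j 1) =
        (polyTranslate j 1).comp (polyTranslate i 1) := by
      refine MvPolynomial.algHom_ext fun l => ?_
      simp only [AlgHom.comp_apply, polyTranslate_X, map_add]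
      split_ifs <;> simp [*]
    exact DFunLike.congr_fun h2 p
  exact DFunLike.congr_fun h a

theorem partialDeriv_comm (i j : Fin n) (a : RatField k n) :
    partialDeriv i (partialDeriv j a) = partialDeriv j (partialDeriv i a) := by
  have h := eq_zero_of_twisted_derivation (RingHom.id (RatField k n))
    ((partialDeriv i).comp (partialDeriv j) - (partialDeriv j).comp (partialDeriv i))
    (fun a b => by
      simp only [AddMonoidHom.sub_apply, AddMonoidHom.comp_apply, partialDeriv_mul, map_add,
        RingHom.id_apply]
      ring)
    (fun p => by
      simp only [AddMonoidHom.sub_apply, AddMonoidHom.comp_apply, partialDeriv_algebraMap]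
      rw [sub_eq_zero]
      refine congrArg (algebraMap _ _) ?_
      have h2 : ⁅MvPolynomial.pderiv (R := k) i, MvPolynomial.pderiv (R := k) j⁆ = 0 := by
        refine MvPolynomial.derivation_ext fun l => ?_
        simp only [Derivation.commutator_apply, MvPolynomial.pderiv_X, Pi.single_apply]
        split_ifs <;> simp
      have h3 := DFunLike.congr_fun h2 p
      rw [Derivation.commutator_apply] at h3
      exact sub_eq_zero.1 h3)
  exact sub_eq_zero.1 (DFunLike.congr_fun h a)

theorem polyTranslate_pderiv (i j : Fin n) (p : MvPolynomial (Fin n) k) :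
    polyTranslate i (1 : k) (MvPolynomial.pderiv j p) =
      MvPolynomial.pderiv j (polyTranslate i 1 p) := by
  induction p using MvPolynomial.induction_on with
  | C c => simp [polyTranslate]
  | add p q hp hq => simp [hp, hq]
  | mul_X p l hp =>
    have hl : polyTranslate i (1 : k) (MvPolynomial.pderiv j (MvPolynomial.X l)) =
        MvPolynomial.pderiv j (polyTranslate i 1 (MvPolynomial.X l)) := by
      rw [polyTranslate_X, map_add]
      by_cases h : l = j
      · subst h; split_ifs <;> simp
      · split_ifs <;> simp [MvPolynomial.pderiv_X_of_ne h]
    simp only [Derivation.leibniz, map_add, map_mul, smul_eq_mul, hp, hl]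

theorem translate_partialDeriv (i j : Fin n) (a : RatField k n) :
    translate i (1 : k) (partialDeriv j a) = partialDeriv j (translate i 1 a) := by
  have h := eq_zero_of_twisted_derivation (translate i (1 : k))
    ((translate i 1).toAddMonoidHom.comp (partialDeriv j) -
      (partialDeriv j).comp (translate i 1).toAddMonoidHom)
    (fun a b => by
      simp only [AddMonoidHom.sub_apply, AddMonoidHom.comp_apply, partialDeriv_mul, map_add,
        RingHom.toAddMonoidHom_eq_coe, AddMonoidHom.coe_coe, map_mul]
      ring)
    (fun p => by
      simp only [AddMonoidHom.sub_apply, AddMonoidHom.comp_apply, partialDeriv_algebraMap,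
        RingHom.toAddMonoidHom_eq_coe, AddMonoidHom.coe_coe, translate_algebraMap,
        polyTranslate_pderiv, sub_self])
  exact sub_eq_zero.1 (DFunLike.congr_fun h a)

theorem translate_succ_emb (i : Fin n) (c : RatField k n) :
    translate i.succ (1 : k) (emb c) = emb (translate i 1 c) := by
  have h : (translate i.succ (1 : k)).comp emb = emb.comp (translate i 1) := by
    refine IsLocalization.ringHom_ext (nonZeroDivisors (MvPolynomial (Fin n) k)) ?_
    refine RingHom.ext fun p => ?_
    simp only [RingHom.comp_apply, translate_algebraMap, emb_algebraMap]
    refine congrArg (algebraMap _ _) ?_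
    have h2 : (polyTranslate i.succ (1 : k)).comp (MvPolynomial.rename Fin.succ) =
        (MvPolynomial.rename Fin.succ).comp (polyTranslate i 1) := by
      refine MvPolynomial.algHom_ext fun l => ?_
      simp only [AlgHom.comp_apply, polyTranslate_X, MvPolynomial.rename_X, map_add, Fin.succ_inj]
      split_ifs <;> simp
    exact DFunLike.congr_fun h2 p
  exact DFunLike.congr_fun h c

theorem partialDeriv_succ_emb (i : Fin n) (c : RatField k n) :
    partialDeriv i.succ (emb c) = emb (partialDeriv i c) := by
  have h := eq_zero_of_twisted_derivation (emb (k := k) (n := n))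
    ((partialDeriv i.succ).comp emb.toAddMonoidHom - emb.toAddMonoidHom.comp (partialDeriv i))
    (fun a b => by
      simp only [AddMonoidHom.sub_apply, AddMonoidHom.comp_apply, partialDeriv_mul, map_add,
        RingHom.toAddMonoidHom_eq_coe, AddMonoidHom.coe_coe, map_mul]
      ring)
    (fun p => by
      simp only [AddMonoidHom.sub_apply, AddMonoidHom.comp_apply, partialDeriv_algebraMap,
        RingHom.toAddMonoidHom_eq_coe, AddMonoidHom.coe_coe, emb_algebraMap]
      rw [sub_eq_zero]
      refine congrArg (algebraMap _ _) ?_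
      exact MvPolynomial.pderiv_rename (Fin.succ_injective n) i p)
  exact sub_eq_zero.1 (DFunLike.congr_fun h c)

end Commutation

/-- The two typical kinds of Ore operators. -/
inductive OreKind
  | shift
  | diff

/-- The ring morphism of an Ore operator: `X i ↦ X i + 1` for a shift, the identity for a
derivation. -/
def OreKind.σ {k : Type*} [Field k] {n : ℕ} (i : Fin n) : OreKind → RatField k n →+* RatField k n
  | .shift => translate i 1
  | .diff => RingHom.id _

/-- The `σ`-derivation of an Ore operator: `0` for a shift, `d / d(X i)` for a derivation. -/
def OreKind.δ {k : Type*} [Field k] {n : ℕ} (i : Fin n) : OreKind → RatField k n →+ RatField k n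
  | .shift => 0
  | .diff => partialDeriv i

/-- The Ore data over `k(X 0, …, X (n - 1))` in which `∂ i` is the shift `X i ↦ X i + 1` or the
derivation `d / d(X i)`, according to `κ i`. -/
def OreData.ofKinds (k : Type*) [Field k] {n : ℕ} (κ : Fin n → OreKind) :
    OreData (RatField k n) (Fin n) where
  σ i := (κ i).σ i
  δ i := (κ i).δ i
  δ_mul i a b := by
    cases κ i
    · simp [OreKind.δ]
    · exact partialDeriv_mul i a b
  σ_comm i j a := by
    cases κ i <;> cases κ j <;> simp only [OreKind.σ, RingHom.id_apply]
    exact translate_comm i j a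
  δ_comm i j a := by
    cases κ i <;> cases κ j <;> simp only [OreKind.δ, AddMonoidHom.zero_apply, map_zero]
    exact partialDeriv_comm i j a
  σ_δ_comm i j _ a := by
    cases κ i <;> cases κ j <;>
      simp only [OreKind.σ, OreKind.δ, AddMonoidHom.zero_apply, map_zero, RingHom.id_apply]
    exact translate_partialDeriv i j a

/-! ### The setting of creative telescoping with respect to `n = x_0` -/

/-- The Ore operators of a summation problem: `∂_0, …, ∂_m` over `k(x_0, …, x_m)` with `∂_0` the
shift `x_0 ↦ x_0 + 1`. The field `base`, together with `σ_emb` and `δ_emb`, says that `∂_1, …, ∂_m`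
restrict to `K = k(x_1, …, x_m)`, i.e. that `K⟨∂_1, …, ∂_m⟩` is an Ore algebra. -/
structure Setting (k : Type*) [Field k] (m : ℕ) where
  total : OreData (RatField k (m + 1)) (Fin (m + 1))
  base : OreData (RatField k m) (Fin m)
  σ_zero : total.σ 0 = translate 0 1
  δ_zero : total.δ 0 = 0
  σ_emb : ∀ i c, total.σ i.succ (emb c) = emb (base.σ i c)
  δ_emb : ∀ i c, total.δ i.succ (emb c) = emb (base.δ i c)

/-- The typical setting: each of `∂_1, …, ∂_m` is a shift or a derivation. -/
def Setting.ofKinds (k : Type*) [Field k] {m : ℕ} (κ : Fin m → OreKind) : Setting k m where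
  total := OreData.ofKinds k (Fin.cons .shift κ : Fin (m + 1) → OreKind)
  base := OreData.ofKinds k κ
  σ_zero := rfl
  δ_zero := rfl
  σ_emb i c := by
    change (κ i).σ i.succ (emb c) = emb ((κ i).σ i c)
    cases κ i
    · exact translate_succ_emb i c
    · rfl
  δ_emb i c := by
    change (κ i).δ i.succ (emb c) = emb ((κ i).δ i c)
    cases κ i
    · exact (map_zero emb).symm
    · exact partialDeriv_succ_emb i c

namespace Setting

variable {k : Type*} [Field k] {m : ℕ} (D : Setting k m)

/-- The Ore algebra `𝔸 = K(x_0)⟨∂_0, …, ∂_m⟩`. -/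
abbrev A : Type _ := OreAlgebra D.total

/-- The Ore algebra `K⟨∂_1, …, ∂_m⟩`. -/
abbrev A' : Type _ := OreAlgebra D.base

/-- The shift operator `S_n = ∂_0` as an element of `𝔸`. -/
def S : D.A := var D.total 0

/-- The difference operator `Δ_n = S_n - 1`. -/
def Delta : D.A := D.S - 1

/-- The exponent of `∂_1^(α_1) ⋯ ∂_m^(α_m)` among the monomials in `∂_0, …, ∂_m`. -/
def embExp (α : Fin m →₀ ℕ) : Fin (m + 1) →₀ ℕ := α.mapDomain Fin.succ

/-- The inclusion `K⟨∂_1, …, ∂_m⟩ ⊆ 𝔸`. -/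
def incl : D.A' →+ D.A :=
  liftAdd fun α => (monomial D.total (embExp α)).comp emb.toAddMonoidHom

theorem incl_monomial (α : Fin m →₀ ℕ) (c : RatField k m) :
    D.incl (monomial D.base α c) = monomial D.total (embExp α) (emb c) :=
  liftAdd_monomial _ _ _

theorem incl_smul (c : RatField k m) (p : D.A') : D.incl (c • p) = emb c • D.incl p := by
  have h : D.incl.comp (DistribSMul.toAddMonoidHom D.A' c) =
      (DistribSMul.toAddMonoidHom D.A (emb c)).comp D.incl := by
    refine addHom_ext fun α d => ?_
    change D.incl (c • monomial D.base α d) = emb c • D.incl (monomial D.base α d)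
    rw [smul_monomial, incl_monomial, incl_monomial, smul_monomial, map_mul]
  exact DFunLike.congr_fun h p

theorem incl_lmulVar (i : Fin m) (p : D.A') :
    D.incl (lmulVar D.base i p) = lmulVar D.total i.succ (D.incl p) := by
  have h : D.incl.comp (lmulVar D.base i) = (lmulVar D.total i.succ).comp D.incl := by
    refine addHom_ext fun α d => ?_
    change D.incl (lmulVar D.base i (monomial D.base α d)) =
      lmulVar D.total i.succ (D.incl (monomial D.base α d))
    rw [lmulVar_monomial, map_add, incl_monomial, incl_monomial, incl_monomial, lmulVar_monomial,
      D.σ_emb, D.δ_emb]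
    simp [embExp, Finsupp.mapDomain_add, Finsupp.mapDomain_single]
  exact DFunLike.congr_fun h p

theorem incl_lmulPow (α : Fin m →₀ ℕ) (p : D.A') :
    D.incl (lmulPow D.base α p) = lmulPow D.total (embExp α) (D.incl p) := by
  unfold embExp
  induction α using Finsupp.induction_linear generalizing p with
  | zero => rw [Finsupp.mapDomain_zero, lmulPow_zero, lmulPow_zero]; rfl
  | add α β hα hβ =>
    rw [Finsupp.mapDomain_add, lmulPow_add, lmulPow_add]
    change D.incl (lmulPow D.base α (lmulPow D.base β p)) =
      lmulPow D.total _ (lmulPow D.total _ (D.incl p))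
    rw [hα, hβ]
  | single i n =>
    rw [Finsupp.mapDomain_single]
    induction n generalizing p with
    | zero => rw [Finsupp.single_zero, Finsupp.single_zero, lmulPow_zero, lmulPow_zero]; rfl
    | succ n ih =>
      rw [Finsupp.single_add, Finsupp.single_add, lmulPow_add, lmulPow_add, lmulPow_single,
        lmulPow_single]
      change D.incl (lmulPow D.base _ (lmulVar D.base i p)) =
        lmulPow D.total _ (lmulVar D.total i.succ (D.incl p))
      rw [ih, incl_lmulVar]

theorem incl_mul (p q : D.A') : D.incl (p * q) = D.incl p * D.incl q := by
  have h : D.incl.comp ((AddMonoidHom.eval q).comp (lmul D.base)) =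
      ((AddMonoidHom.eval (D.incl q)).comp (lmul D.total)).comp D.incl := by
    refine addHom_ext fun α d => ?_
    change D.incl (lmul D.base (monomial D.base α d) q) =
      lmul D.total (D.incl (monomial D.base α d)) (D.incl q)
    rw [lmul_monomial, incl_smul, incl_lmulPow, incl_monomial, lmul_monomial]
  exact DFunLike.congr_fun h p

/-- Elements of `K⟨∂_1, …, ∂_m⟩` commute with `Δ_n`. -/
theorem incl_mul_Delta (p : D.A') : D.incl p * D.Delta = D.Delta * D.incl p := by
  have h : (AddMonoidHom.mulRight D.S).comp D.incl = (AddMonoidHom.mulLeft D.S).comp D.incl := by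
    refine addHom_ext fun α d => ?_
    change D.incl (monomial D.base α d) * D.S = D.S * D.incl (monomial D.base α d)
    rw [incl_monomial, S, var_mul, lmulVar_monomial, D.σ_zero, D.δ_zero, translate_zero_emb,
      AddMonoidHom.zero_apply, map_zero, add_zero, var, mul_def, lmul_monomial,
      lmulPow_monomial_one, smul_monomial, mul_one]
  have h' : D.incl p * D.S = D.S * D.incl p := DFunLike.congr_fun h p
  rw [Delta, mul_sub, sub_mul, h', mul_one, one_mul]

/-- The telescoping ideal `T_I = (I + Δ_n 𝔸) ∩ K⟨∂_1, …, ∂_m⟩`, a left ideal of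
`K⟨∂_1, …, ∂_m⟩`. -/
def telescopingIdeal (I : Submodule D.A D.A) : Submodule D.A' D.A' where
  carrier := {T | ∃ a ∈ I, ∃ G : D.A, D.incl T = a + D.Delta * G}
  zero_mem' := ⟨0, I.zero_mem, 0, by simp⟩
  add_mem' := by
    rintro T T' ⟨a, ha, G, h⟩ ⟨a', ha', G', h'⟩
    exact ⟨a + a', I.add_mem ha ha', G + G', by rw [map_add, h, h', mul_add]; abel⟩
  smul_mem' := by
    rintro c T ⟨a, ha, G, h⟩
    refine ⟨D.incl c * a, I.smul_mem (D.incl c) ha, D.incl c * G, ?_⟩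
    rw [smul_eq_mul, incl_mul, h, mul_add, ← mul_assoc, incl_mul_Delta, mul_assoc]

/-! ### Operators in `S_n`, cyclic vectors, adjoints, canonical forms -/

/-- Operators `∑ a_i S_n^i` in `K(x_0)⟨S_n⟩`, stored as the family of the `a_i`. -/
abbrev OpS (k : Type*) [Field k] (m : ℕ) : Type _ := ℕ →₀ RatField k (m + 1)

/-- The operator `∑ a_i S_n^i` as an element of `𝔸`. -/
def ofOpS (P : OpS k m) : D.A := P.sum fun i a => a • D.S ^ i

/-- The order of an operator in `S_n`. -/
def OpS.order (P : OpS k m) : ℕ := P.support.sup id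

/-- The map `R ↦ P^*(R)` on rational functions defined by the adjoint
`P^* = ∑ a_i(x_0 - i) S_n^(-i)` of `P = ∑ a_i S_n^i`. -/
def OpS.adjoint (P : OpS k m) (R : RatField k (m + 1)) : RatField k (m + 1) :=
  P.sum fun i a => translate 0 (-(i : k)) a * translate 0 (-(i : k)) R

/-- `γ` is a cyclic vector of `𝔹 = 𝔸 / I` with respect to `S_n`: with `r = dim 𝔹`, the family
`γ, S_n γ, …, S_n^(r-1) γ` is a basis of `𝔹` over `K(x_0)`. -/
def IsCyclicVector {I : Submodule D.A D.A} (γ : D.A ⧸ I) : Prop :=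
  LinearIndependent (RatField k (m + 1))
      (fun i : Fin (Module.finrank (RatField k (m + 1)) (D.A ⧸ I)) => D.S ^ (i : ℕ) • γ) ∧
    Submodule.span (RatField k (m + 1))
      (Set.range fun i : Fin (Module.finrank (RatField k (m + 1)) (D.A ⧸ I)) =>
        D.S ^ (i : ℕ) • γ) = ⊤

/-- `L` is a nonzero operator in `S_n` of minimal order annihilating `γ`. -/
def IsMinimalAnnihilator {I : Submodule D.A D.A} (γ : D.A ⧸ I) (L : OpS k m) : Prop :=
  L ≠ 0 ∧ D.ofOpS L • γ = 0 ∧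
    ∀ P : OpS k m, P ≠ 0 → D.ofOpS P • γ = 0 → OpS.order L ≤ OpS.order P

/-- A canonical form associated to `L^*`: a `K`-linear map `[·]` with `[L^*(R)] = 0` and
`R - [R]` in the image of `L^*`, for all rational functions `R`. -/
structure IsCanonicalForm (L : OpS k m) (c : RatField k (m + 1) → RatField k (m + 1)) : Prop where
  map_add : ∀ R R', c (R + R') = c R + c R'
  map_smul : ∀ (a : RatField k m) R, c (emb a * R) = emb a * c R
  map_adjoint : ∀ R, c (OpS.adjoint L R) = 0
  sub_mem : ∀ R, ∃ R', R - c R = OpS.adjoint L R'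

/-- The map `φ_i(R) = B_i^*(σ_i(R)) + δ_i(R)`, where `B_i` is such that `∂_i γ = B_i γ`. It is
`B_i^*(R(x_i + 1))` when `∂_i` is the shift and `B_i^*(R) + dR/dx_i` when `∂_i` is `d/dx_i`. -/
def phi (B : Fin m → OpS k m) (i : Fin m) (R : RatField k (m + 1)) : RatField k (m + 1) :=
  OpS.adjoint (B i) (D.total.σ i.succ R) + D.total.δ i.succ R

end Setting

/-! ### Gröbner bases for the grevlex order -/

/-- The strict graded reverse lexicographic order on the monomials in `∂_1, …, ∂_m`, for
`∂_1 < ⋯ < ∂_m`. (Indices start at `0` in `Fin m`.) -/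
def GrevlexLT {m : ℕ} (α β : Fin m →₀ ℕ) : Prop :=
  α.degree < β.degree ∨
    α.degree = β.degree ∧ ∃ i, (∀ j, j < i → α j = β j) ∧ β i < α i

/-- `∂^α` is the leading monomial of `p` for the grevlex order. -/
def IsLeadingMonomial {F : Type*} [Field F] {m : ℕ} {D : OreData F (Fin m)}
    (p : OreAlgebra D) (α : Fin m →₀ ℕ) : Prop :=
  α ∈ p.support ∧ ∀ β ∈ p.support, β ≠ α → GrevlexLT β α

/-- `G` is a Gröbner basis of the left ideal `T` for the grevlex order: a finite subset of `T` such
that the leading monomial of every nonzero element of `T` is a multiple of the leading monomial of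
an element of `G`. -/
def IsGroebnerBasis {F : Type*} [Field F] {m : ℕ} {D : OreData F (Fin m)}
    (G : Set (OreAlgebra D)) (T : Submodule (OreAlgebra D) (OreAlgebra D)) : Prop :=
  G.Finite ∧ G ⊆ T ∧
    ∀ f ∈ T, f ≠ 0 → ∃ g ∈ G, ∃ α β, IsLeadingMonomial g α ∧ IsLeadingMonomial f β ∧ α ≤ β

/-! ### The algorithm -/

namespace Setting

variable {k : Type*} [Field k] {m : ℕ} (D : Setting k m)

/-- The variables of the algorithm: the list `𝓛` of monomials to visit, the current `𝓖`, the
current `𝓠`, the rational functions `R_α` stored for `α ∈ 𝓠`, and the current `𝓡`. A monomial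
`∂^α` in `∂_1, …, ∂_m` is stored as its exponent `α`. -/
structure State where
  toVisit : List (Fin m →₀ ℕ)
  basis : List D.A'
  quotient : List (Fin m →₀ ℕ)
  red : (Fin m →₀ ℕ) → RatField k (m + 1)
  reducible : List (Fin m →₀ ℕ)

/-- The initial state: `𝓛 = [1]`, and the other lists are empty. -/
def initial : D.State where
  toVisit := [0]
  basis := []
  quotient := []
  red := fun _ => 0
  reducible := []

variable {D}

/-- `∂^α` is a multiple of an element of `𝓡`. -/
def State.IsReducible (s : D.State) (α : Fin m →₀ ℕ) : Prop := ∃ β ∈ s.reducible, β ≤ α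

/-- `R` is a possible value of `R_α` computed in state `s`: the canonical form of `A₁^*(1)` if
`α = 0`, and otherwise the canonical form of `φ_j(R_β)` where `∂^α = ∂_j ∂^β` with `β ∈ 𝓠`. -/
def State.Computes (s : D.State) (A₁ : OpS k m) (B : Fin m → OpS k m)
    (c : RatField k (m + 1) → RatField k (m + 1)) (α : Fin m →₀ ℕ)
    (R : RatField k (m + 1)) : Prop :=
  (α = 0 ∧ R = c (OpS.adjoint A₁ 1)) ∨
    (α ≠ 0 ∧ ∃ j : Fin m, ∃ β ∈ s.quotient, α = β + Finsupp.single j 1 ∧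
      R = c (D.phi B j (s.red β)))

/-- The family `(a_β)` of elements of `K`, indexed by `β ∈ 𝓠`, satisfies
`R = ∑ a_β R_β`. -/
def State.IsRelation (s : D.State) (R : RatField k (m + 1))
    (a : (Fin m →₀ ℕ) →₀ RatField k m) : Prop :=
  (∀ β ∈ a.support, β ∈ s.quotient) ∧ R = a.sum fun β x => emb x * s.red β

/-- The element `∂^α - ∑ a_β ∂^β` of `K⟨∂_1, …, ∂_m⟩`. -/
def telescoper (D : Setting k m) (α : Fin m →₀ ℕ) (a : (Fin m →₀ ℕ) →₀ RatField k m) : D.A' :=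
  monomial D.base α 1 - a.sum fun β x => monomial D.base β x

/-- Append to `l` the monomials `∂_1 ∂^α, …, ∂_m ∂^α`, in this order, except those that `l` already
contains. -/
def appendMultiples (l : List (Fin m →₀ ℕ)) (α : Fin m →₀ ℕ) : List (Fin m →₀ ℕ) :=
  l ++ ((List.finRange m).map fun j => α + Finsupp.single j 1).filter fun β => β ∉ l

/-- One pass through the body of the `while` loop. There is no pass from a state with `𝓛 = ∅`,
where the algorithm stops and returns `𝓖`. -/
inductive Step (A₁ : OpS k m) (B : Fin m → OpS k m)
    (c : RatField k (m + 1) → RatField k (m + 1)) : D.State → D.State → Prop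
  /-- The first monomial of `𝓛` is a multiple of an element of `𝓡`. -/
  | skip (s : D.State) (α : Fin m →₀ ℕ) (l : List (Fin m →₀ ℕ))
      (hl : s.toVisit = α :: l) (hred : s.IsReducible α) :
      Step A₁ B c s { s with toVisit := l }
  /-- There is a linear relation `R_α = ∑ a_β R_β`. -/
  | relation (s : D.State) (α : Fin m →₀ ℕ) (l : List (Fin m →₀ ℕ)) (R : RatField k (m + 1))
      (a : (Fin m →₀ ℕ) →₀ RatField k m)
      (hl : s.toVisit = α :: l) (hred : ¬ s.IsReducible α)
      (hR : s.Computes A₁ B c α R) (ha : s.IsRelation R a) :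
      Step A₁ B c s
        { s with
          toVisit := l
          basis := s.basis ++ [D.telescoper α a]
          reducible := s.reducible ++ [α] }
  /-- There is no such relation. -/
  | independent (s : D.State) (α : Fin m →₀ ℕ) (l : List (Fin m →₀ ℕ)) (R : RatField k (m + 1))
      (hl : s.toVisit = α :: l) (hred : ¬ s.IsReducible α)
      (hR : s.Computes A₁ B c α R) (ha : ¬ ∃ a, s.IsRelation R a) :
      Step A₁ B c s
        { s with
          toVisit := appendMultiples l α
          quotient := s.quotient ++ [α]
          red := Function.update s.red α R }

variable (D)

/-- The state `s` occurs in some run of the algorithm. -/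
def Reachable (A₁ : OpS k m) (B : Fin m → OpS k m)
    (c : RatField k (m + 1) → RatField k (m + 1)) (s : D.State) : Prop :=
  Relation.ReflTransGen (Step A₁ B c) D.initial s

/-- The algorithm terminates: no run goes through the loop infinitely often, and no run is
stuck with `𝓛 ≠ ∅`. -/
def Terminates (A₁ : OpS k m) (B : Fin m → OpS k m)
    (c : RatField k (m + 1) → RatField k (m + 1)) : Prop :=
  (¬ ∃ f : ℕ → D.State, f 0 = D.initial ∧ ∀ i, Step A₁ B c (f i) (f (i + 1))) ∧
    ∀ s, D.Reachable A₁ B c s → s.toVisit ≠ [] → ∃ t, Step A₁ B c s t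

/-- Some run of the algorithm stops and returns `G`. -/
def Outputs (A₁ : OpS k m) (B : Fin m → OpS k m)
    (c : RatField k (m + 1) → RatField k (m + 1)) (G : List D.A') : Prop :=
  ∃ s, D.Reachable A₁ B c s ∧ s.toVisit = [] ∧ s.basis = G

end Setting

end CreativeTelescoping

end

/-!
Write `𝔹 = 𝔸 / I`, a left module over `K⟨∂_1, …, ∂_m⟩`, in which `Δ_n 𝔹` is a submodule because
the `∂_i` with `i ≥ 1` and the elements of `K` commute with `Δ_n`. The telescoping ideal is the
annihilator of the class of `1` in `𝔹 / Δ_n 𝔹` (`mem_telescopingIdeal_iff`).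

Every element of `𝔹` is `Q γ` for an operator `Q` in `S_n`, and summation by parts gives `Q γ ≡
Q^*(1) γ` modulo `Δ_n 𝔹` (`smul_ofOpS_smul_sub_mem`). If `Q γ = Δ_n P γ`, then `Q - Δ_n P` is a
left multiple of `L`, so that `Q^*(1)` lies in the image of `L^*`
(`IsMinimalAnnihilator.exists_adjoint_eq`). Hence `Q γ ↦ [Q^*(1)]` is a well-defined `K`-linear
map on `𝔹` with kernel `Δ_n 𝔹`, which turns the action of `∂_j` into `R ↦ [φ_j(R)]`
(`exists_reduction`). Consequently the `R_α` of the algorithm do not depend on the choices made: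
they are the values `ρ (∂^α)` of a `K`-linear map `ρ` whose kernel is the telescoping ideal `T`
(`exists_normalForm`), and the linear relations that the algorithm looks for are the elements of
`T`.

What remains is a statement about an arbitrary left ideal `T` with a normal form `ρ`. The
monomials that are not leading monomials of `T` are linearly independent modulo `T`
(`linearIndepOn_monomial`), and together with leading monomials of `T` they allow any monomial to
be reduced modulo `T` (`monomial_mem_sup_span`). The algorithm visits the monomials in increasing
grevlex order, except for multiples of elements of `𝓡`, which it skips; this is the role of the
way `𝓛` is extended, and it rests on `GrevlexLT.add_single_of_support_le` and
`Invariant.lt_add_single`. Therefore `𝓠` only receives monomials that are not leading monomials of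
`T`, and `𝓡` only leading monomials, each being the leading monomial of an element of `𝓖`. At the
end every monomial is in `𝓠` or is a multiple of an element of `𝓡`, so that `𝓖` is a Gröbner basis
and `𝓠` is finite and spans the quotient by `T`. Conversely, if the quotient is
finite-dimensional, its dimension bounds the length of `𝓠`, and each pass that does not enlarge
`𝓠` shortens `𝓛` (`Invariant.measure_lt`).
-/

noncomputable section

namespace CreativeTelescoping

open OreAlgebra

/-! ### The grevlex order -/

section Grevlex

variable {m : ℕ} {α β γ : Fin m →₀ ℕ}

theorem GrevlexLT.degree_le (h : GrevlexLT α β) : α.degree ≤ β.degree := by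
  rcases h with h | h
  · exact h.le
  · exact h.1.le

theorem GrevlexLT.irrefl (α : Fin m →₀ ℕ) : ¬ GrevlexLT α α := by
  rintro (h | ⟨-, i, -, h⟩) <;> exact lt_irrefl _ h

theorem GrevlexLT.trans (h : GrevlexLT α β) (h' : GrevlexLT β γ) : GrevlexLT α γ := by
  rcases h with h | ⟨h, i, hi, hi'⟩
  · exact Or.inl (h.trans_le h'.degree_le)
  rcases h' with h' | ⟨h', j, hj, hj'⟩
  · exact Or.inl (h.trans_lt h')
  refine Or.inr ⟨h.trans h', ?_⟩
  rcases lt_trichotomy i j with hij | rfl | hij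
  · exact ⟨i, fun l hl => (hi l hl).trans (hj l (hl.trans hij)), hj i hij ▸ hi'⟩
  · exact ⟨i, fun l hl => (hi l hl).trans (hj l hl), hj'.trans hi'⟩
  · exact ⟨j, fun l hl => (hi l (hl.trans hij)).trans (hj l hl), (hi j hij).symm ▸ hj'⟩

theorem GrevlexLT.ne (h : GrevlexLT α β) : α ≠ β := by
  rintro rfl
  exact irrefl _ h

theorem GrevlexLT.asymm (h : GrevlexLT α β) : ¬ GrevlexLT β α :=
  fun h' => irrefl _ (h.trans h')

theorem grevlexLT_or_of_ne (h : α ≠ β) : GrevlexLT α β ∨ GrevlexLT β α := by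
  rcases lt_trichotomy α.degree β.degree with hd | hd | hd
  · exact Or.inl (Or.inl hd)
  · obtain ⟨i, hi, hmin⟩ := (wellFounded_lt (α := Fin m)).has_min {i | α i ≠ β i}
      (Finsupp.ne_iff.1 h)
    have hlt : ∀ j, j < i → α j = β j := fun j hj => by
      by_contra hne
      exact hmin j hne hj
    rcases lt_or_gt_of_ne hi with h' | h'
    · exact Or.inr (Or.inr ⟨hd.symm, i, fun j hj => (hlt j hj).symm, h'⟩)
    · exact Or.inl (Or.inr ⟨hd, i, hlt, h'⟩)
  · exact Or.inr (Or.inl hd)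

theorem GrevlexLT.add_right (h : GrevlexLT α β) (γ : Fin m →₀ ℕ) :
    GrevlexLT (α + γ) (β + γ) := by
  rcases h with h | ⟨h, i, hi, hi'⟩
  · exact Or.inl (by simpa [map_add] using h)
  · exact Or.inr ⟨by simpa [map_add] using h, i,
      fun j hj => by simp [hi j hj], by simpa using hi'⟩

theorem grevlexLT_add_single (α : Fin m →₀ ℕ) (j : Fin m) :
    GrevlexLT α (α + Finsupp.single j 1) :=
  Or.inl (by simp [map_add])

theorem eq_or_grevlexLT_of_le (h : α ≤ β) : α = β ∨ GrevlexLT α β := by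
  obtain ⟨γ, rfl⟩ := exists_add_of_le h
  by_cases hγ : γ = 0
  · simp [hγ]
  · refine Or.inr (Or.inl ?_)
    have : γ.degree ≠ 0 := by rwa [Ne, Finsupp.degree_eq_zero_iff]
    rw [map_add]
    omega

theorem not_grevlexLT_zero (α : Fin m →₀ ℕ) : ¬ GrevlexLT α 0 := by
  intro h
  rcases eq_or_grevlexLT_of_le (zero_le (a := α)) with rfl | h'
  · exact GrevlexLT.irrefl _ h
  · exact h.asymm h'

theorem finite_grevlexLT (α : Fin m →₀ ℕ) : {β | GrevlexLT β α}.Finite :=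
  (Finsupp.finite_of_degree_le α.degree).subset fun _ h => GrevlexLT.degree_le h

/-- The rank of a monomial in the grevlex order. It embeds the monomials in `ℕ`, which gives
well-founded induction and maxima of finite sets. -/
def grevlexRank (α : Fin m →₀ ℕ) : ℕ := {β | GrevlexLT β α}.ncard

theorem GrevlexLT.rank_lt (h : GrevlexLT α β) : grevlexRank α < grevlexRank β :=
  Set.ncard_lt_ncard
    ⟨fun _ h' => GrevlexLT.trans h' h, fun hs => irrefl α (hs h)⟩ (finite_grevlexLT β)

theorem wellFounded_grevlexLT : WellFounded (GrevlexLT (m := m)) :=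
  Subrelation.wf (fun h => GrevlexLT.rank_lt h) (measure grevlexRank).wf

theorem grevlexLT_add_single_of_lt (α : Fin m →₀ ℕ) {i j : Fin m} (h : i < j) :
    GrevlexLT (α + Finsupp.single i 1) (α + Finsupp.single j 1) := by
  refine Or.inr ⟨by simp [map_add], i, fun l hl => ?_, ?_⟩
  · simp [hl.ne', (hl.trans h).ne']
  · simp [h.ne']

/-- If `∂_j` is at least as large as every variable of `∂^β`, then `∂_j ∂^β` comes after all
multiples `∂_i ∂^α` of the monomials `∂^α` before `∂^β` of the same degree. -/
theorem GrevlexLT.add_single_of_support_le (h : GrevlexLT α β) (hd : α.degree = β.degree)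
    (i j : Fin m) (hj : ∀ t, j < t → β t = 0) :
    GrevlexLT (α + Finsupp.single i 1) (β + Finsupp.single j 1) := by
  rcases h with h | ⟨-, t, ht, ht'⟩
  · exact absurd hd h.ne
  have hjt : t < j := by
    by_contra hcon
    -- otherwise `β ≤ α` with a strict inequality at `t`, against the equality of the degrees
    have hle : ∀ l, β l ≤ α l := fun l => by
      rcases lt_trichotomy l t with hl | rfl | hl
      · exact (ht l hl).ge
      · exact ht'.le
      · rw [hj l ((not_lt.1 hcon).trans_lt hl)]
        exact Nat.zero_le _
    rw [Finsupp.degree_eq_sum, Finsupp.degree_eq_sum] at hd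
    exact (Finset.sum_lt_sum (fun l _ => hle l) ⟨t, Finset.mem_univ t, ht'⟩).ne' hd
  refine Or.inr ⟨by simp [map_add, hd], ?_⟩
  rcases lt_or_ge i t with hit | hit
  · refine ⟨i, fun l hl => ?_, ?_⟩
    · have h1 : i ≠ l := hl.ne'
      have h2 : j ≠ l := ((hl.trans hit).trans hjt).ne'
      simp [h1, h2, ht l (hl.trans hit)]
    · have h2 : j ≠ i := (hit.trans hjt).ne'
      simp [h2, ht i hit]
  · refine ⟨t, fun l hl => ?_, ?_⟩
    · have h1 : i ≠ l := (hl.trans_le hit).ne'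
      have h2 : j ≠ l := (hl.trans hjt).ne'
      simp [h1, h2, ht l hl]
    · have h2 : j ≠ t := hjt.ne'
      have h3 : α t ≤ (α + Finsupp.single i 1 : Fin m →₀ ℕ) t := by simp
      have h4 : (β + Finsupp.single j 1 : Fin m →₀ ℕ) t = β t := by simp [h2]
      omega

/-- If `∂^α` has a variable larger than `∂_j`, then `∂_j ∂^α` is a multiple of an earlier monomial
than `∂^α`, of the same degree. -/
theorem exists_grevlexLT_add_single_eq {j t : Fin m} (hjt : j < t) (ht : α t ≠ 0) :
    ∃ β, GrevlexLT β α ∧ α + Finsupp.single j 1 = β + Finsupp.single t 1 := by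
  have hle : Finsupp.single t 1 ≤ α := by
    rw [Finsupp.single_le_iff]
    omega
  obtain ⟨β, rfl⟩ := exists_add_of_le hle
  refine ⟨β + Finsupp.single j 1, ?_, by abel⟩
  rw [add_comm (Finsupp.single t 1)]
  exact grevlexLT_add_single_of_lt β hjt

end Grevlex

/-! ### Leading monomials of a left ideal -/

section LeadingExponents

variable {F : Type*} [Field F] {m : ℕ} {D : OreData F (Fin m)}

theorem exists_isLeadingMonomial {f : OreAlgebra D} (hf : f ≠ 0) :
    ∃ α, IsLeadingMonomial f α := by
  have hne : f.support.Nonempty := Finsupp.support_nonempty_iff.2 hf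
  obtain ⟨α, hα, hmax⟩ := Finset.exists_max_image f.support grevlexRank hne
  refine ⟨α, hα, fun β hβ hne => ?_⟩
  rcases grevlexLT_or_of_ne hne with h | h
  · exact h
  · exact absurd h.rank_lt (hmax β hβ).not_gt

variable (D) in
/-- The linear combinations of the monomials strictly smaller than `∂^α`. -/
def lowerSpan (α : Fin m →₀ ℕ) : Submodule F (OreAlgebra D) :=
  Submodule.span F ((fun β => monomial D β 1) '' {β | GrevlexLT β α})

theorem lowerSpan_mono {α β : Fin m →₀ ℕ} (h : GrevlexLT α β) : lowerSpan D α ≤ lowerSpan D β :=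
  Submodule.span_mono (Set.image_mono fun _ h' => GrevlexLT.trans h' h)

theorem monomial_mem_lowerSpan {α β : Fin m →₀ ℕ} (h : GrevlexLT β α) (c : F) :
    monomial D β c ∈ lowerSpan D α := by
  have h1 := (lowerSpan D α).smul_mem c (Submodule.subset_span ⟨β, h, rfl⟩)
  rwa [smul_monomial, mul_one] at h1

theorem var_mul_monomial_one (j : Fin m) (α : Fin m →₀ ℕ) :
    var D j * monomial D α 1 = monomial D (α + Finsupp.single j 1) 1 := by
  rw [var, mul_def, lmul_monomial, one_smul, lmulPow_monomial_one, add_comm]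

theorem var_mul_smul (j : Fin m) (c : F) (p : OreAlgebra D) :
    var D j * (c • p) = D.σ j c • (var D j * p) + D.δ j c • p := by
  rw [var_mul, var_mul, lmulVar_smul]

theorem var_mul_mem_lowerSpan (j : Fin m) {α : Fin m →₀ ℕ} {p : OreAlgebra D}
    (hp : p ∈ lowerSpan D α) : var D j * p ∈ lowerSpan D (α + Finsupp.single j 1) := by
  induction hp using Submodule.span_induction with
  | mem x hx =>
    obtain ⟨β, hβ, rfl⟩ := hx
    rw [var_mul_monomial_one]
    exact monomial_mem_lowerSpan (GrevlexLT.add_right hβ _) 1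
  | zero => rw [mul_zero]; exact zero_mem _
  | add x y _ _ hx hy => rw [mul_add]; exact add_mem hx hy
  | smul c x hx ih =>
    rw [var_mul_smul]
    exact add_mem (Submodule.smul_mem _ _ ih)
      (Submodule.smul_mem _ _ (lowerSpan_mono (grevlexLT_add_single α j) hx))

/-- The left ideal `T` contains an element with leading monomial `∂^α`, here normalized to have
leading coefficient `1`. -/
def IsLeadingExponent (T : Submodule (OreAlgebra D) (OreAlgebra D)) (α : Fin m →₀ ℕ) : Prop :=
  ∃ p ∈ lowerSpan D α, monomial D α 1 - p ∈ T

variable {T : Submodule (OreAlgebra D) (OreAlgebra D)}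

theorem IsLeadingExponent.add_single {α : Fin m →₀ ℕ} (h : IsLeadingExponent T α) (j : Fin m) :
    IsLeadingExponent T (α + Finsupp.single j 1) := by
  obtain ⟨p, hp, hT⟩ := h
  refine ⟨var D j * p, var_mul_mem_lowerSpan j hp, ?_⟩
  rw [← var_mul_monomial_one, ← mul_sub]
  exact T.smul_mem (var D j) hT

theorem IsLeadingExponent.of_le {α β : Fin m →₀ ℕ} (h : IsLeadingExponent T α) (hle : α ≤ β) :
    IsLeadingExponent T β := by
  obtain ⟨γ, rfl⟩ := exists_add_of_le hle
  clear hle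
  induction γ using Finsupp.induction_linear generalizing α with
  | zero => rwa [add_zero]
  | add γ γ' h1 h2 => rw [← add_assoc]; exact h2 (h1 h)
  | single i n =>
    induction n with
    | zero => rwa [Finsupp.single_zero, add_zero]
    | succ n ih => rw [Finsupp.single_add, ← add_assoc]; exact ih.add_single i

theorem sum_monomial (f : OreAlgebra D) :
    ∑ β ∈ f.support, monomial D β (f.coeff β) = f :=
  Finsupp.sum_single f

theorem coeff_ne_zero {f : OreAlgebra D} {α : Fin m →₀ ℕ} (h : α ∈ f.support) :
    f.coeff α ≠ 0 :=
  Finsupp.mem_support_iff.1 h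

theorem IsLeadingMonomial.isLeadingExponent {f : OreAlgebra D} {α : Fin m →₀ ℕ}
    (h : IsLeadingMonomial f α) (hf : f ∈ T) : IsLeadingExponent T α := by
  classical
  set c := f.coeff α
  have hc : c ≠ 0 := coeff_ne_zero h.1
  refine ⟨-(c⁻¹ • ∑ β ∈ f.support.erase α, monomial D β (f.coeff β)), ?_, ?_⟩
  · refine neg_mem (Submodule.smul_mem _ _ (Submodule.sum_mem _ fun β hβ => ?_))
    exact monomial_mem_lowerSpan (h.2 β (Finset.mem_of_mem_erase hβ) (Finset.ne_of_mem_erase hβ)) _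
  · have h1 : monomial D α 1 = c⁻¹ • monomial D α c := by
      rw [smul_monomial, inv_mul_cancel₀ hc]
    rw [h1, sub_neg_eq_add, ← smul_add,
      Finset.add_sum_erase f.support (fun β => monomial D β (f.coeff β)) h.1, sum_monomial]
    exact (T.restrictScalars F).smul_mem c⁻¹ hf

/-- If each monomial of an initial segment `P` of the monomials either belongs to `Q` or is a
leading monomial of `T`, then `Q` spans the monomials of `P` modulo `T`. -/
theorem monomial_mem_sup_span {Q : Set (Fin m →₀ ℕ)} {P : (Fin m →₀ ℕ) → Prop}
    (hP : ∀ μ ν, GrevlexLT ν μ → P μ → P ν)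
    (hQ : ∀ μ, P μ → μ ∈ Q ∨ IsLeadingExponent T μ) (μ : Fin m →₀ ℕ) (hμ : P μ) :
    monomial D μ 1 ∈
      T.restrictScalars F ⊔ Submodule.span F ((fun β => monomial D β 1) '' Q) := by
  induction μ using wellFounded_grevlexLT.induction with
  | _ μ ih =>
    rcases hQ μ hμ with h | ⟨p, hp, hT⟩
    · exact Submodule.mem_sup_right (Submodule.subset_span ⟨μ, h, rfl⟩)
    · rw [← sub_add_cancel (monomial D μ 1) p]
      refine add_mem (Submodule.mem_sup_left hT) ?_
      have hle : lowerSpan D μ ≤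
          T.restrictScalars F ⊔ Submodule.span F ((fun β => monomial D β 1) '' Q) := by
        refine Submodule.span_le.2 ?_
        rintro _ ⟨ν, hν, rfl⟩
        exact ih ν hν (hP μ ν hν hμ)
      exact hle hp

theorem isDFinite_of_finite {Q : Set (Fin m →₀ ℕ)} (hfin : Q.Finite)
    (hQ : ∀ μ, μ ∈ Q ∨ IsLeadingExponent T μ) : IsDFinite T := by
  have htop : T.restrictScalars F ⊔ Submodule.span F ((fun β => monomial D β 1) '' Q) = ⊤ := by
    refine eq_top_iff.2 fun f _ => ?_
    rw [← sum_monomial f]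
    refine Submodule.sum_mem _ fun β _ => ?_
    rw [← mul_one (f.coeff β), ← smul_monomial]
    exact Submodule.smul_mem _ _ (monomial_mem_sup_span (P := fun _ => True)
      (fun _ _ _ _ => trivial) (fun μ _ => hQ μ) β trivial)
  let π : OreAlgebra D →ₗ[F] OreAlgebra D ⧸ T := T.mkQ.restrictScalars F
  have hπ : LinearMap.range π = ⊤ := LinearMap.range_eq_top.2 (Submodule.mkQ_surjective T)
  have hfg : (⊤ : Submodule F (OreAlgebra D ⧸ T)).FG := by
    have hker : Submodule.map π (T.restrictScalars F) = ⊥ := by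
      refine eq_bot_iff.2 ?_
      rintro _ ⟨x, hx, rfl⟩
      exact (Submodule.Quotient.mk_eq_zero T).2 hx
    rw [← hπ, LinearMap.range_eq_map, ← htop, Submodule.map_sup, hker, bot_sup_eq]
    exact (Submodule.fg_span (hfin.image _)).map π
  exact ⟨hfg⟩

/-- The monomials that are not leading monomials of `T` are linearly independent modulo `T`. -/
theorem linearIndepOn_monomial {Q : Set (Fin m →₀ ℕ)} (hQ : ∀ q ∈ Q, ¬ IsLeadingExponent T q) :
    LinearIndepOn F (fun β => (Submodule.Quotient.mk (monomial D β 1) : OreAlgebra D ⧸ T)) Q := by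
  rw [linearIndepOn_iff]
  intro l hl h0
  by_contra hne
  let f : OreAlgebra D := l
  have hf : f ∈ T := by
    rw [← Submodule.Quotient.mk_eq_zero, ← h0, Finsupp.linearCombination_apply]
    conv_lhs => rw [← sum_monomial f]
    change T.mkQ _ = _
    rw [map_sum]
    refine Finset.sum_congr rfl fun β _ => ?_
    rw [← mul_one (f.coeff β), ← smul_monomial]
    rfl
  obtain ⟨α, hα⟩ := exists_isLeadingMonomial (f := f) hne
  exact hQ α (hl hα.1) (hα.isLeadingExponent hf)

/-- A set of monomials that are not leading monomials of `T` has at most `dim (K⟨∂⟩ / T)`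
elements. -/
theorem length_le_finrank (hT : IsDFinite T) (Q : List (Fin m →₀ ℕ)) (hnd : Q.Nodup)
    (hQ : ∀ q ∈ Q, ¬ IsLeadingExponent T q) :
    Q.length ≤ Module.finrank F (OreAlgebra D ⧸ T) := by
  classical
  have : Module.Finite F (OreAlgebra D ⧸ T) := hT
  have h := (linearIndepOn_monomial (Q := {q | q ∈ Q.toFinset})
    (fun q hq => hQ q (List.mem_toFinset.1 hq))).fintype_card_le_finrank
  rw [← List.toFinset_card_of_nodup hnd, ← Fintype.card_coe]
  exact h

end LeadingExponents

/-! ### Operators in the shift and their adjoints -/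

namespace Setting

section Adjoint

variable {k : Type*} [Field k] {m : ℕ}

theorem translate_zero (R : RatField k (m + 1)) : translate 0 0 R = R := by
  have h : translate (0 : Fin (m + 1)) (0 : k) = RingHom.id _ := by
    refine IsLocalization.ringHom_ext (nonZeroDivisors (MvPolynomial (Fin (m + 1)) k)) ?_
    refine RingHom.ext fun p => ?_
    simp only [RingHom.comp_apply, translate_algebraMap, RingHom.id_apply]
    refine congrArg (algebraMap _ _) ?_
    have h2 : polyTranslate (0 : Fin (m + 1)) (0 : k) = AlgHom.id k _ := by
      refine MvPolynomial.algHom_ext fun j => ?_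
      simp [polyTranslate_X]
    exact DFunLike.congr_fun h2 p
  exact DFunLike.congr_fun h R

theorem translate_translate (a b : k) (R : RatField k (m + 1)) :
    translate 0 a (translate 0 b R) = translate 0 (a + b) R := by
  have h : (translate (0 : Fin (m + 1)) a).comp (translate 0 b) = translate 0 (a + b) := by
    refine IsLocalization.ringHom_ext (nonZeroDivisors (MvPolynomial (Fin (m + 1)) k)) ?_
    refine RingHom.ext fun p => ?_
    simp only [RingHom.comp_apply, translate_algebraMap]
    refine congrArg (algebraMap _ _) ?_
    have h2 : (polyTranslate (0 : Fin (m + 1)) a).comp (polyTranslate 0 b) =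
        polyTranslate 0 (a + b) := by
      refine MvPolynomial.algHom_ext fun j => ?_
      simp only [AlgHom.comp_apply, polyTranslate_X, map_add]
      split_ifs
      · simp [MvPolynomial.algHom_C, add_assoc]
      · simp
    exact DFunLike.congr_fun h2 p
  exact DFunLike.congr_fun h R

theorem adjoint_single (i : ℕ) (a R : RatField k (m + 1)) :
    OpS.adjoint (Finsupp.single i a) R = translate 0 (-(i : k)) (a * R) := by
  rw [map_mul]
  exact Finsupp.sum_single_index (by rw [map_zero, zero_mul])

theorem adjoint_zero (R : RatField k (m + 1)) : OpS.adjoint (0 : OpS k m) R = 0 :=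
  Finsupp.sum_zero_index

theorem adjoint_add (P Q : OpS k m) (R : RatField k (m + 1)) :
    OpS.adjoint (P + Q) R = OpS.adjoint P R + OpS.adjoint Q R := by
  classical
  exact Finsupp.sum_add_index' (by simp) fun i a b => by rw [map_add, add_mul]

theorem adjoint_sub (P Q : OpS k m) (R : RatField k (m + 1)) :
    OpS.adjoint (P - Q) R = OpS.adjoint P R - OpS.adjoint Q R :=
  eq_sub_of_add_eq (by rw [← adjoint_add, sub_add_cancel])

theorem adjoint_add_right (P : OpS k m) (R R' : RatField k (m + 1)) :
    OpS.adjoint P (R + R') = OpS.adjoint P R + OpS.adjoint P R' := by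
  simp only [OpS.adjoint, map_add, mul_add, Finsupp.sum_add]

theorem adjoint_zero_right (P : OpS k m) : OpS.adjoint P 0 = 0 := by
  simp [OpS.adjoint]

theorem adjoint_smul (u : RatField k (m + 1)) (P : OpS k m) (R : RatField k (m + 1)) :
    OpS.adjoint (u • P) R = OpS.adjoint P (u * R) := by
  induction P using Finsupp.induction_linear with
  | zero => rw [smul_zero, adjoint_zero, adjoint_zero]
  | add P Q hP hQ => rw [smul_add, adjoint_add, adjoint_add, hP, hQ]
  | single i a =>
    rw [Finsupp.smul_single, adjoint_single, adjoint_single, smul_eq_mul, mul_assoc, mul_left_comm]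

theorem adjoint_emb_mul (P : OpS k m) (a : RatField k m) (R : RatField k (m + 1)) :
    OpS.adjoint P (emb a * R) = emb a * OpS.adjoint P R := by
  induction P using Finsupp.induction_linear with
  | zero => rw [adjoint_zero, adjoint_zero, mul_zero]
  | add P Q hP hQ => rw [adjoint_add, adjoint_add, hP, hQ, mul_add]
  | single i b =>
    rw [adjoint_single, adjoint_single, mul_left_comm, map_mul, translate_zero_emb]

/-- The product `S_n P` as an operator in `S_n`. -/
def shiftMul : OpS k m →+ OpS k m :=
  Finsupp.liftAddHom fun i =>
    (Finsupp.singleAddHom (i + 1)).comp (translate (0 : Fin (m + 1)) (1 : k)).toAddMonoidHom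

theorem shiftMul_single (i : ℕ) (a : RatField k (m + 1)) :
    shiftMul (Finsupp.single i a : OpS k m) = Finsupp.single (i + 1) (translate 0 1 a) :=
  Finsupp.liftAddHom_apply_single _ _ _

theorem shiftMul_succ (P : OpS k m) (i : ℕ) : shiftMul P (i + 1) = translate 0 1 (P i) := by
  classical
  induction P using Finsupp.induction_linear with
  | zero => simp
  | add P Q hP hQ =>
    rw [map_add shiftMul P Q, Finsupp.add_apply, hP, hQ, Finsupp.add_apply, map_add]
  | single j a =>
    rw [shiftMul_single, Finsupp.single_apply, Finsupp.single_apply]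
    by_cases h : j = i <;> simp [h]

theorem adjoint_shiftMul (P : OpS k m) (R : RatField k (m + 1)) :
    OpS.adjoint (shiftMul P) R = OpS.adjoint P (translate 0 (-1) R) := by
  induction P using Finsupp.induction_linear with
  | zero => rw [map_zero, adjoint_zero, adjoint_zero]
  | add P Q hP hQ => rw [map_add, adjoint_add, adjoint_add, hP, hQ]
  | single i a =>
    rw [shiftMul_single, adjoint_single, adjoint_single, map_mul, map_mul, translate_translate,
      translate_translate]
    push_cast
    congr 3 <;> ring

theorem adjoint_iterate_shiftMul (d : ℕ) (P : OpS k m) (R : RatField k (m + 1)) :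
    ∃ R', OpS.adjoint (shiftMul^[d] P) R = OpS.adjoint P R' := by
  induction d generalizing R with
  | zero => exact ⟨R, rfl⟩
  | succ d ih =>
    obtain ⟨R', h⟩ := ih (translate 0 (-1) R)
    exact ⟨R', by rw [Function.iterate_succ_apply', adjoint_shiftMul, h]⟩

theorem iterate_shiftMul_ne_zero (d : ℕ) {P : OpS k m} {i : ℕ} (h : P i ≠ 0) :
    shiftMul^[d] P (i + d) ≠ 0 := by
  induction d with
  | zero => exact h
  | succ d ih =>
    rw [Function.iterate_succ_apply', ← add_assoc, shiftMul_succ]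
    exact (map_ne_zero _).2 ih

theorem iterate_shiftMul_eq_zero (d : ℕ) {P : OpS k m} {l : ℕ} (h : ∀ i, l < i → P i = 0) :
    ∀ i, l + d < i → shiftMul^[d] P i = 0 := by
  induction d with
  | zero => exact h
  | succ d ih =>
    rintro (_ | i) hi
    · omega
    · rw [Function.iterate_succ_apply', shiftMul_succ, ih i (by omega), map_zero]

theorem OpS.apply_order_ne_zero {P : OpS k m} (h : P ≠ 0) : P (OpS.order P) ≠ 0 := by
  obtain ⟨i, hi, h'⟩ := Finset.exists_mem_eq_sup P.support (Finsupp.support_nonempty_iff.2 h) id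
  rw [OpS.order, h']
  exact Finsupp.mem_support_iff.1 hi

theorem OpS.apply_eq_zero_of_order_lt {P : OpS k m} {i : ℕ} (h : OpS.order P < i) : P i = 0 := by
  by_contra hne
  exact (Finset.le_sup (f := id) (Finsupp.mem_support_iff.2 hne)).not_gt h

theorem OpS.order_le {P : OpS k m} {N : ℕ} (h : ∀ i, N < i → P i = 0) : OpS.order P ≤ N :=
  Finset.sup_le fun i hi => by
    by_contra hlt
    exact Finsupp.mem_support_iff.1 hi (h i (not_le.1 hlt))

end Adjoint

/-! ### Reduction of `𝔸 / I` modulo `Δ_n` -/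

section Reduction

variable {k : Type*} [Field k] {m : ℕ} {D : Setting k m} {I : Submodule D.A D.A}

theorem mul_smul_quotient (p : D.A) (R : RatField k (m + 1)) (b : D.A ⧸ I) :
    (R • p) • b = R • p • b := smul_assoc R p b

theorem var_smul_smul (j : Fin (m + 1)) (R : RatField k (m + 1)) (b : D.A ⧸ I) :
    var D.total j • R • b = D.total.σ j R • var D.total j • b + D.total.δ j R • b := by
  obtain ⟨p, rfl⟩ := Submodule.mkQ_surjective I b
  have h : var D.total j * (R • p) =
      D.total.σ j R • (var D.total j * p) + D.total.δ j R • p := by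
    rw [var_mul, var_mul, lmulVar_smul]
  exact congrArg I.mkQ h

theorem S_smul_smul (R : RatField k (m + 1)) (b : D.A ⧸ I) :
    D.S • R • b = translate 0 1 R • D.S • b := by
  rw [S, var_smul_smul, D.σ_zero, D.δ_zero, AddMonoidHom.zero_apply, zero_smul, add_zero]

theorem Delta_smul (b : D.A ⧸ I) : D.Delta • b = D.S • b - b := by
  rw [Delta, sub_smul, one_smul]

theorem var_succ_smul_Delta_smul (j : Fin m) (b : D.A ⧸ I) :
    var D.total j.succ • D.Delta • b = D.Delta • var D.total j.succ • b := by
  have h : D.incl (var D.base j) = var D.total j.succ := by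
    rw [var, incl_monomial, embExp, Finsupp.mapDomain_single, map_one]
    rfl
  rw [← mul_smul, ← mul_smul, ← h, incl_mul_Delta]

variable (I) in
/-- The subgroup `Δ_n (𝔸 / I)`. -/
def deltaRange : AddSubgroup (D.A ⧸ I) :=
  (DistribSMul.toAddMonoidHom (D.A ⧸ I) D.Delta).range

theorem Delta_smul_mem (b : D.A ⧸ I) : D.Delta • b ∈ deltaRange I := ⟨b, rfl⟩

theorem var_succ_smul_mem (j : Fin m) {b : D.A ⧸ I} (hb : b ∈ deltaRange I) :
    var D.total j.succ • b ∈ deltaRange I := by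
  obtain ⟨b', rfl⟩ := hb
  exact ⟨var D.total j.succ • b', (var_succ_smul_Delta_smul j b').symm⟩

theorem S_pow_smul_sub_mem (i : ℕ) (b : D.A ⧸ I) : D.S ^ i • b - b ∈ deltaRange I := by
  induction i with
  | zero => rw [pow_zero, one_smul, sub_self]; exact zero_mem _
  | succ i ih =>
    have h : D.S ^ (i + 1) • b - b = D.Delta • D.S ^ i • b + (D.S ^ i • b - b) := by
      rw [Delta_smul, pow_succ', mul_smul]
      abel
    rw [h]
    exact add_mem (Delta_smul_mem _) ih

theorem ofOpS_add (P Q : OpS k m) : D.ofOpS (P + Q) = D.ofOpS P + D.ofOpS Q := by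
  classical
  exact Finsupp.sum_add_index' (fun _ => zero_smul _ _) fun _ _ _ => add_smul _ _ _

theorem ofOpS_zero : D.ofOpS (0 : OpS k m) = 0 := Finsupp.sum_zero_index

theorem ofOpS_sub (P Q : OpS k m) : D.ofOpS (P - Q) = D.ofOpS P - D.ofOpS Q :=
  eq_sub_of_add_eq (by rw [← ofOpS_add, sub_add_cancel])

theorem ofOpS_single (i : ℕ) (a : RatField k (m + 1)) :
    D.ofOpS (Finsupp.single i a) = a • D.S ^ i :=
  Finsupp.sum_single_index (zero_smul _ _)

theorem ofOpS_smul (u : RatField k (m + 1)) (P : OpS k m) :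
    D.ofOpS (u • P) = u • D.ofOpS P := by
  induction P using Finsupp.induction_linear with
  | zero => rw [smul_zero, ofOpS_zero, smul_zero]
  | add P Q hP hQ => rw [smul_add, ofOpS_add, ofOpS_add, hP, hQ, smul_add]
  | single i a => rw [Finsupp.smul_single, ofOpS_single, ofOpS_single, smul_eq_mul, mul_smul]

theorem ofOpS_shiftMul_smul (P : OpS k m) (b : D.A ⧸ I) :
    D.ofOpS (shiftMul P) • b = D.S • D.ofOpS P • b := by
  induction P using Finsupp.induction_linear with
  | zero => rw [map_zero, ofOpS_zero, zero_smul, smul_zero]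
  | add P Q hP hQ => rw [map_add, ofOpS_add, ofOpS_add, add_smul, add_smul, smul_add, hP, hQ]
  | single i a =>
    rw [shiftMul_single, ofOpS_single, ofOpS_single, mul_smul_quotient, mul_smul_quotient,
      S_smul_smul, pow_succ', mul_smul]

theorem ofOpS_iterate_shiftMul_smul_eq_zero (d : ℕ) {P : OpS k m} {b : D.A ⧸ I}
    (h : D.ofOpS P • b = 0) : D.ofOpS (shiftMul^[d] P) • b = 0 := by
  induction d with
  | zero => exact h
  | succ d ih => rw [Function.iterate_succ_apply', ofOpS_shiftMul_smul, ih, smul_zero]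

/-- Summation by parts: `R P γ` and `P^*(R) γ` agree modulo `Δ_n`. -/
theorem smul_ofOpS_smul_sub_mem (P : OpS k m) (R : RatField k (m + 1)) (b : D.A ⧸ I) :
    R • D.ofOpS P • b - OpS.adjoint P R • b ∈ deltaRange I := by
  induction P using Finsupp.induction_linear with
  | zero =>
    rw [ofOpS_zero, adjoint_zero, zero_smul, smul_zero, zero_smul, sub_zero]
    exact zero_mem _
  | add P Q hP hQ =>
    rw [ofOpS_add, adjoint_add, add_smul, smul_add, add_smul, add_sub_add_comm]
    exact add_mem hP hQ
  | single i a =>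
    have hS : ∀ (i : ℕ) (x : RatField k (m + 1)),
        D.S ^ i • x • b = translate 0 (i : k) x • D.S ^ i • b := by
      intro i x
      induction i with
      | zero => rw [pow_zero, one_smul, one_smul, Nat.cast_zero, translate_zero]
      | succ i ih =>
        rw [pow_succ', mul_smul, mul_smul, ih, S_smul_smul, translate_translate, Nat.cast_succ,
          add_comm (1 : k)]
    have h : R • D.ofOpS (Finsupp.single i a) • b =
        D.S ^ i • OpS.adjoint (Finsupp.single i a) R • b := by
      rw [hS, adjoint_single, translate_translate, add_neg_cancel, translate_zero, ofOpS_single,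
        mul_smul_quotient, smul_smul, mul_comm]
    rw [h]
    exact S_pow_smul_sub_mem i _

variable {γ : D.A ⧸ I} {L : OpS k m}

/-- Right division by `L`: if `Q γ = 0` then `Q = U L`, and `(U L)^*(1) = L^*(U^*(1))`. -/
theorem IsMinimalAnnihilator.exists_adjoint_eq (hL : D.IsMinimalAnnihilator γ L) (Q : OpS k m)
    (hQ : D.ofOpS Q • γ = 0) : ∃ R, OpS.adjoint Q 1 = OpS.adjoint L R := by
  obtain ⟨hL0, hLγ, hmin⟩ := hL
  suffices h : ∀ (N : ℕ) (Q : OpS k m), (∀ i, N ≤ i → Q i = 0) → D.ofOpS Q • γ = 0 →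
      ∃ R, OpS.adjoint Q 1 = OpS.adjoint L R from
    h (OpS.order Q + 1) Q (fun i hi => OpS.apply_eq_zero_of_order_lt hi) hQ
  intro N
  induction N with
  | zero =>
    intro Q hQ0 _
    have hQ0 : Q = 0 := Finsupp.ext fun i => hQ0 i (Nat.zero_le i)
    exact ⟨0, by rw [hQ0, adjoint_zero, adjoint_zero_right]⟩
  | succ N ih =>
    intro Q hQN hQ
    by_cases hN : Q N = 0
    · refine ih Q (fun i hi => ?_) hQ
      rcases hi.eq_or_lt with rfl | hi
      · exact hN
      · exact hQN i hi
    have hle : OpS.order L ≤ N :=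
      (hmin Q (fun h => hN (by rw [h]; rfl)) hQ).trans (OpS.order_le hQN)
    obtain ⟨d, rfl⟩ := Nat.exists_eq_add_of_le hle
    -- `u S_n^d L` has the same leading term as `Q`
    set u := Q (OpS.order L + d) / shiftMul^[d] L (OpS.order L + d) with hu
    have hcoeff : ∀ i, OpS.order L + d ≤ i → (Q - u • shiftMul^[d] L) i = 0 := by
      intro i hi
      rw [Finsupp.sub_apply, Finsupp.smul_apply, smul_eq_mul]
      rcases hi.eq_or_lt with rfl | hi
      · rw [hu, div_mul_cancel₀ _ (iterate_shiftMul_ne_zero d (OpS.apply_order_ne_zero hL0)),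
          sub_self]
      · rw [hQN i hi, iterate_shiftMul_eq_zero d (fun _ => OpS.apply_eq_zero_of_order_lt) i hi,
          mul_zero, sub_self]
    have hann : D.ofOpS (Q - u • shiftMul^[d] L) • γ = 0 := by
      rw [ofOpS_sub, sub_smul, hQ, ofOpS_smul, mul_smul_quotient,
        ofOpS_iterate_shiftMul_smul_eq_zero d hLγ, smul_zero, sub_zero]
    obtain ⟨R, hR⟩ := ih _ hcoeff hann
    obtain ⟨R', hR'⟩ := adjoint_iterate_shiftMul d L u
    refine ⟨R + R', ?_⟩
    rw [adjoint_add_right, ← hR, ← hR', adjoint_sub, adjoint_smul, mul_one, sub_add_cancel]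

theorem IsCyclicVector.exists_ofOpS_smul_eq (hγ : D.IsCyclicVector γ) (b : D.A ⧸ I) :
    ∃ P : OpS k m, D.ofOpS P • γ = b := by
  have hb : b ∈ Submodule.span (RatField k (m + 1))
      (Set.range fun i : Fin (Module.finrank (RatField k (m + 1)) (D.A ⧸ I)) =>
        D.S ^ (i : ℕ) • γ) := hγ.2 ▸ Submodule.mem_top
  induction hb using Submodule.span_induction with
  | mem x hx =>
    obtain ⟨i, rfl⟩ := hx
    exact ⟨Finsupp.single i 1, by rw [ofOpS_single, one_smul]⟩
  | zero => exact ⟨0, by rw [ofOpS_zero, zero_smul]⟩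
  | add x y _ _ hx hy =>
    obtain ⟨P, rfl⟩ := hx
    obtain ⟨Q, rfl⟩ := hy
    exact ⟨P + Q, by rw [ofOpS_add, add_smul]⟩
  | smul a x _ hx =>
    obtain ⟨P, rfl⟩ := hx
    exact ⟨a • P, by rw [ofOpS_smul, mul_smul_quotient]⟩

variable {c : RatField k (m + 1) → RatField k (m + 1)}

theorem IsCanonicalForm.map_sub (hc : IsCanonicalForm L c)
    (R R' : RatField k (m + 1)) : c (R - R') = c R - c R' :=
  eq_sub_of_add_eq (by rw [← hc.map_add, sub_add_cancel])

/-- `c (Q^*(1))` depends only on the class of `Q γ` modulo `Δ_n`. -/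
theorem canonicalForm_adjoint_one_eq_zero (hγ : D.IsCyclicVector γ)
    (hL : D.IsMinimalAnnihilator γ L) (hc : IsCanonicalForm L c) {Q : OpS k m}
    (hQ : D.ofOpS Q • γ ∈ deltaRange I) : c (OpS.adjoint Q 1) = 0 := by
  obtain ⟨b, hb⟩ := hQ
  obtain ⟨P, rfl⟩ := hγ.exists_ofOpS_smul_eq b
  change D.Delta • D.ofOpS P • γ = _ at hb
  -- `Q - Δ_n P` annihilates `γ` and `(Δ_n P)^*(1) = 0`
  obtain ⟨R, hR⟩ := hL.exists_adjoint_eq (Q - (shiftMul P - P)) (by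
    rw [ofOpS_sub, ofOpS_sub, sub_smul, sub_smul, ofOpS_shiftMul_smul, ← hb, Delta_smul, sub_self])
  rw [adjoint_sub, adjoint_sub, adjoint_shiftMul, map_one, sub_self, sub_zero] at hR
  rw [hR, hc.map_adjoint]

theorem adjoint_smul_mem (hL : D.IsMinimalAnnihilator γ L) (R : RatField k (m + 1)) :
    OpS.adjoint L R • γ ∈ deltaRange I := by
  have h := smul_ofOpS_smul_sub_mem L R γ
  rw [hL.2.1, smul_zero, zero_sub] at h
  exact neg_mem_iff.1 h

theorem smul_sub_canonicalForm_smul_mem (hL : D.IsMinimalAnnihilator γ L)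
    (hc : IsCanonicalForm L c) (R : RatField k (m + 1)) : R • γ - c R • γ ∈ deltaRange I := by
  obtain ⟨R', h⟩ := hc.sub_mem R
  rw [← sub_smul, h]
  exact adjoint_smul_mem hL R'

/-- The isomorphism of `(𝔸 / I) / Δ_n (𝔸 / I)` with the canonical forms, `Q γ ↦ [Q^*(1)]`, and its
compatibility with the action of `∂_j`. -/
theorem exists_reduction (hγ : D.IsCyclicVector γ) (hL : D.IsMinimalAnnihilator γ L)
    {B : Fin m → OpS k m} (hB : ∀ i, var D.total i.succ • γ = D.ofOpS (B i) • γ)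
    (hc : IsCanonicalForm L c) :
    ∃ e : (D.A ⧸ I) →+ RatField k (m + 1),
      (∀ Q : OpS k m, e (D.ofOpS Q • γ) = c (OpS.adjoint Q 1)) ∧
      (∀ b, e b = 0 ↔ b ∈ deltaRange I) ∧
      (∀ (a : RatField k m) b, e (emb a • b) = emb a * e b) ∧
      ∀ j b, e (var D.total j.succ • b) = c (D.phi B j (e b)) := by
  choose q hq using hγ.exists_ofOpS_smul_eq
  have key : ∀ (b : D.A ⧸ I) (Q : OpS k m), D.ofOpS Q • γ = b →
      c (OpS.adjoint (q b) 1) = c (OpS.adjoint Q 1) := by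
    intro b Q hQ
    rw [← sub_eq_zero, ← hc.map_sub, ← adjoint_sub]
    refine canonicalForm_adjoint_one_eq_zero hγ hL hc ?_
    rw [ofOpS_sub, sub_smul, hq, hQ, sub_self]
    exact zero_mem _
  let e : (D.A ⧸ I) →+ RatField k (m + 1) := AddMonoidHom.mk' (fun b => c (OpS.adjoint (q b) 1))
    (fun b b' => by
      rw [key (b + b') (q b + q b') (by rw [ofOpS_add, add_smul, hq, hq]), adjoint_add, hc.map_add])
  have he : ∀ Q : OpS k m, e (D.ofOpS Q • γ) = c (OpS.adjoint Q 1) := fun Q => key _ Q rfl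
  have he_smul : ∀ R : RatField k (m + 1), e (R • γ) = c R := by
    intro R
    have h := he (Finsupp.single 0 R)
    rwa [ofOpS_single, pow_zero, mul_smul_quotient, one_smul, adjoint_single, Nat.cast_zero,
      neg_zero, translate_zero, mul_one] at h
  have hsub : ∀ b, b - e b • γ ∈ deltaRange I := by
    intro b
    have h1 := smul_ofOpS_smul_sub_mem (q b) 1 γ
    rw [one_smul, hq] at h1
    have h2 := add_mem h1 (smul_sub_canonicalForm_smul_mem hL hc (OpS.adjoint (q b) 1))
    rwa [sub_add_sub_cancel] at h2
  have hker : ∀ b, e b = 0 ↔ b ∈ deltaRange I := by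
    refine fun b => ⟨fun h => ?_, fun h => ?_⟩
    · have h1 := hsub b
      rwa [h, zero_smul, sub_zero] at h1
    · rw [← hq b] at h ⊢
      rw [he]
      exact canonicalForm_adjoint_one_eq_zero hγ hL hc h
  have hcongr : ∀ b b', b - b' ∈ deltaRange I → e b = e b' := by
    intro b b' h
    rwa [← sub_eq_zero, ← map_sub, hker]
  refine ⟨e, he, hker, fun a b => ?_, fun j b => ?_⟩
  · obtain ⟨Q, rfl⟩ := hγ.exists_ofOpS_smul_eq b
    rw [← mul_smul_quotient, ← ofOpS_smul, he, he, adjoint_smul, adjoint_emb_mul, hc.map_smul]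
  · -- replace `b` by `R γ`, expand `∂_j R γ = σ_j(R) B_j γ + δ_j(R) γ`, and sum by parts
    have h1 : e (var D.total j.succ • b) = e (var D.total j.succ • e b • γ) := by
      refine hcongr _ _ ?_
      rw [← smul_sub]
      exact var_succ_smul_mem j (hsub b)
    rw [h1, var_smul_smul, hB, ← he_smul]
    refine hcongr _ _ ?_
    rw [phi, add_smul, add_sub_add_right_eq_sub]
    exact smul_ofOpS_smul_sub_mem _ _ _

theorem mem_telescopingIdeal_iff (p : D.A') :
    p ∈ D.telescopingIdeal I ↔
      D.incl p • (Submodule.Quotient.mk 1 : D.A ⧸ I) ∈ deltaRange I := by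
  have h1 : D.incl p • (Submodule.Quotient.mk 1 : D.A ⧸ I) = Submodule.Quotient.mk (D.incl p) := by
    rw [← Submodule.Quotient.mk_smul, smul_eq_mul, mul_one]
  rw [h1]
  constructor
  · rintro ⟨a, ha, G, h⟩
    refine ⟨Submodule.Quotient.mk G, ?_⟩
    rw [h, Submodule.Quotient.mk_add, (Submodule.Quotient.mk_eq_zero I).2 ha, zero_add]
    rfl
  · rintro ⟨b, hb⟩
    obtain ⟨G, rfl⟩ := Submodule.Quotient.mk_surjective I b
    have h : D.incl p - D.Delta * G ∈ I := (Submodule.Quotient.eq I).1 hb.symm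
    exact ⟨_, h, G, (sub_add_cancel _ _).symm⟩

/-- The value `R_α` computed by the algorithm is `ρ (∂^α)` for a `K`-linear map `ρ` on
`K⟨∂_1, …, ∂_m⟩` whose kernel is the telescoping ideal, whatever choices are made. -/
theorem exists_normalForm (hγ : D.IsCyclicVector γ) (hL : D.IsMinimalAnnihilator γ L)
    {A₁ : OpS k m} (hA₁ : D.ofOpS A₁ • γ = Submodule.Quotient.mk 1)
    {B : Fin m → OpS k m} (hB : ∀ i, var D.total i.succ • γ = D.ofOpS (B i) • γ)
    (hc : IsCanonicalForm L c) :
    ∃ ρ : D.A' →+ RatField k (m + 1),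
      (∀ (a : RatField k m) p, ρ (a • p) = emb a * ρ p) ∧
      (∀ p, ρ p = 0 ↔ p ∈ D.telescopingIdeal I) ∧
      ρ 1 = c (OpS.adjoint A₁ 1) ∧
      ∀ j p, ρ (var D.base j * p) = c (D.phi B j (ρ p)) := by
  obtain ⟨e, he, hker, hsmul, hvar⟩ := exists_reduction hγ hL hB hc
  have hincl : D.incl 1 = 1 := by
    rw [one_def, incl_monomial, map_one, embExp, Finsupp.mapDomain_zero]
    rfl
  refine ⟨AddMonoidHom.mk' (fun p => e (D.incl p • (Submodule.Quotient.mk 1 : D.A ⧸ I)))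
    (fun p q => by rw [map_add, add_smul, map_add]), fun a p => ?_, fun p => ?_, ?_, fun j p => ?_⟩
  · change e (D.incl (a • p) • _) = emb a * e _
    rw [incl_smul, mul_smul_quotient, hsmul]
  · exact (hker _).trans (mem_telescopingIdeal_iff p).symm
  · change e (D.incl 1 • _) = _
    rw [hincl, one_smul, ← hA₁, he]
  · change e (D.incl (var D.base j * p) • _) = c (D.phi B j (e _))
    rw [var_mul, incl_lmulVar, ← var_mul, mul_smul, hvar]

end Reduction

/-! ### The invariant of the loop -/

section Algorithm

variable {k : Type*} [Field k] {m : ℕ} {D : Setting k m}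

/-- What holds between two passes of the loop, `ρ` being a normal form modulo the left ideal `T`.
The multiples of the elements of `𝓡` may stand anywhere in `𝓛`, since they are skipped: only the
other elements of `𝓛` are sorted. -/
structure Invariant (T : Submodule D.A' D.A') (ρ : D.A' →+ RatField k (m + 1))
    (s : D.State) : Prop where
  sorted : s.toVisit.Pairwise fun x y =>
    ¬ s.IsReducible x → ¬ s.IsReducible y → GrevlexLT x y
  quotient_lt : ∀ q ∈ s.quotient, ∀ ν ∈ s.toVisit, ¬ s.IsReducible ν → GrevlexLT q ν
  zero_mem : 0 ∈ s.quotient ∨ 0 ∈ s.toVisit ∨ s.IsReducible 0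
  add_single_mem : ∀ β ∈ s.quotient, ∀ j, β + Finsupp.single j 1 ∈ s.quotient ∨
    β + Finsupp.single j 1 ∈ s.toVisit ∨ s.IsReducible (β + Finsupp.single j 1)
  parent : ∀ ν ∈ s.toVisit, ν = 0 ∨ ∃ β ∈ s.quotient, ∃ j, ν = β + Finsupp.single j 1
  red_eq : ∀ β ∈ s.quotient, s.red β = ρ (monomial D.base β 1)
  standard : ∀ β ∈ s.quotient, ¬ IsLeadingExponent T β
  nodup : s.quotient.Nodup
  basis_mem : ∀ g ∈ s.basis, g ∈ T
  leading : ∀ α ∈ s.reducible, ∃ g ∈ s.basis, IsLeadingMonomial g α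

theorem State.IsReducible.of_le {s : D.State} {α β : Fin m →₀ ℕ} (h : s.IsReducible α)
    (hle : α ≤ β) : s.IsReducible β := by
  obtain ⟨δ, hδ, h⟩ := h
  exact ⟨δ, hδ, h.trans hle⟩

variable {T : Submodule D.A' D.A'} {ρ : D.A' →+ RatField k (m + 1)} {s : D.State}

theorem invariant_initial : Invariant T ρ D.initial where
  sorted := List.pairwise_singleton _ _
  quotient_lt := by simp [initial]
  zero_mem := by simp [initial]
  add_single_mem := by simp [initial]
  parent := by simp [initial]
  red_eq := by simp [initial]
  standard := by simp [initial]
  nodup := List.nodup_nil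
  basis_mem := by simp [initial]
  leading := by simp [initial]

namespace Invariant

theorem isLeadingExponent_of_isReducible (hs : Invariant T ρ s) {α : Fin m →₀ ℕ}
    (h : s.IsReducible α) : IsLeadingExponent T α := by
  obtain ⟨β, hβ, hle⟩ := h
  obtain ⟨g, hg, hlead⟩ := hs.leading β hβ
  exact (hlead.isLeadingExponent (hs.basis_mem g hg)).of_le hle

/-- A monomial that is neither in `𝓠` nor a multiple of an element of `𝓡` has a divisor in `𝓛`: on a
path from `1` to it through its divisors, the first monomial outside `𝓠`. -/
theorem mem_or_exists_le (hs : Invariant T ρ s) (μ : Fin m →₀ ℕ) (hμ : ¬ s.IsReducible μ) :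
    μ ∈ s.quotient ∨ ∃ ν ∈ s.toVisit, ν ≤ μ := by
  induction μ using wellFounded_grevlexLT.induction with
  | _ μ ih =>
    by_cases h0 : μ = 0
    · subst h0
      rcases hs.zero_mem with h | h | h
      · exact Or.inl h
      · exact Or.inr ⟨0, h, le_rfl⟩
      · exact absurd h hμ
    · obtain ⟨j, hj⟩ := Finsupp.ne_iff.1 h0
      have hle : Finsupp.single j 1 ≤ μ := by
        rw [Finsupp.single_le_iff]
        exact Nat.one_le_iff_ne_zero.2 hj
      obtain ⟨β, rfl⟩ : ∃ β, μ = β + Finsupp.single j 1 := ⟨_, (tsub_add_cancel_of_le hle).symm⟩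
      have hβ : β ≤ β + Finsupp.single j 1 := le_self_add
      rcases ih β (grevlexLT_add_single β j) (fun h => hμ (h.of_le hβ)) with h | ⟨ν, hν, hle⟩
      · rcases hs.add_single_mem β h j with h | h | h
        · exact Or.inl h
        · exact Or.inr ⟨_, h, le_rfl⟩
        · exact absurd h hμ
      · exact Or.inr ⟨ν, hν, hle.trans hβ⟩

/-- All monomials smaller than the first element `∂^α` of `𝓛` have been dealt with, if `∂^α` is
not to be skipped. -/
theorem mem_or_isReducible_of_lt (hs : Invariant T ρ s) {α : Fin m →₀ ℕ} {l : List (Fin m →₀ ℕ)}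
    (hl : s.toVisit = α :: l) (hα : ¬ s.IsReducible α) {μ : Fin m →₀ ℕ} (hμ : GrevlexLT μ α) :
    μ ∈ s.quotient ∨ s.IsReducible μ := by
  refine or_iff_not_imp_right.2 fun hred => ?_
  refine (hs.mem_or_exists_le μ hred).resolve_right ?_
  rintro ⟨ν, hν, hle⟩
  have hlt : GrevlexLT ν α := by
    rcases eq_or_grevlexLT_of_le hle with rfl | h
    · exact hμ
    · exact h.trans hμ
  rw [hl] at hν
  rcases List.mem_cons.1 hν with rfl | hν
  · exact GrevlexLT.irrefl _ hlt
  · have hsort := hs.sorted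
    rw [hl, List.pairwise_cons] at hsort
    exact hlt.asymm (hsort.1 ν hν hα fun h => hred (h.of_le hle))

theorem eq_of_computes (hs : Invariant T ρ s) {A₁ : OpS k m} {B : Fin m → OpS k m}
    {c : RatField k (m + 1) → RatField k (m + 1)} (h1 : ρ 1 = c (OpS.adjoint A₁ 1))
    (hvar : ∀ j p, ρ (var D.base j * p) = c (D.phi B j (ρ p))) {α : Fin m →₀ ℕ}
    {R : RatField k (m + 1)} (hR : s.Computes A₁ B c α R) : R = ρ (monomial D.base α 1) := by
  rcases hR with ⟨rfl, rfl⟩ | ⟨-, j, β, hβ, rfl, rfl⟩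
  · exact h1.symm
  · rw [hs.red_eq β hβ, ← hvar, var_mul_monomial_one]

theorem exists_computes (hs : Invariant T ρ s) (A₁ : OpS k m) (B : Fin m → OpS k m)
    (c : RatField k (m + 1) → RatField k (m + 1)) {α : Fin m →₀ ℕ} (hα : α ∈ s.toVisit) :
    ∃ R, s.Computes A₁ B c α R := by
  by_cases h0 : α = 0
  · exact ⟨_, Or.inl ⟨h0, rfl⟩⟩
  · obtain ⟨β, hβ, j, h⟩ := (hs.parent α hα).resolve_left h0
    exact ⟨_, Or.inr ⟨h0, j, β, hβ, h, rfl⟩⟩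

theorem isRelation_iff (hs : Invariant T ρ s)
    (hsmul : ∀ (a : RatField k m) p, ρ (a • p) = emb a * ρ p)
    (hker : ∀ p, ρ p = 0 ↔ p ∈ T) (α : Fin m →₀ ℕ) (a : (Fin m →₀ ℕ) →₀ RatField k m) :
    s.IsRelation (ρ (monomial D.base α 1)) a ↔
      (∀ β ∈ a.support, β ∈ s.quotient) ∧ D.telescoper α a ∈ T := by
  refine and_congr_right fun ha => ?_
  have hsum : (a.sum fun β x => emb x * s.red β) = ρ (a.sum fun β x => monomial D.base β x) := by
    rw [Finsupp.sum, Finsupp.sum, map_sum]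
    refine Finset.sum_congr rfl fun β hβ => ?_
    rw [hs.red_eq β (ha β hβ), ← hsmul, smul_monomial, mul_one]
  rw [hsum, ← hker, telescoper, map_sub, sub_eq_zero]

/-- If the first element `∂^α` of `𝓛` is a leading monomial of `T`, then the algorithm finds a
relation: the smaller monomials, hence `∂^α` too, are congruent modulo `T` to combinations of
elements of `𝓠`. -/
theorem exists_isRelation (hs : Invariant T ρ s)
    (hsmul : ∀ (a : RatField k m) p, ρ (a • p) = emb a * ρ p)
    (hker : ∀ p, ρ p = 0 ↔ p ∈ T) {α : Fin m →₀ ℕ} {l : List (Fin m →₀ ℕ)}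
    (hl : s.toVisit = α :: l) (hα : ¬ s.IsReducible α) (hT : IsLeadingExponent T α) :
    ∃ a, s.IsRelation (ρ (monomial D.base α 1)) a := by
  have hspan : monomial D.base α 1 ∈ T.restrictScalars (RatField k m) ⊔
      Submodule.span (RatField k m) ((fun β => monomial D.base β 1) '' {q | q ∈ s.quotient}) := by
    refine monomial_mem_sup_span (P := fun μ => μ = α ∨ GrevlexLT μ α) ?_ ?_ α (Or.inl rfl)
    · rintro μ ν hν (rfl | hμ)
      · exact Or.inr hν
      · exact Or.inr (hν.trans hμ)
    · rintro μ (rfl | hμ)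
      · exact Or.inr hT
      · exact (hs.mem_or_isReducible_of_lt hl hα hμ).imp_right hs.isLeadingExponent_of_isReducible
  obtain ⟨t, ht, y, hy, hty⟩ := Submodule.mem_sup.1 hspan
  obtain ⟨a, ha, rfl⟩ := (Finsupp.mem_span_image_iff_linearCombination _).1 hy
  refine ⟨a, (hs.isRelation_iff hsmul hker α a).2 ⟨fun β hβ => ha hβ, ?_⟩⟩
  have hsum : (a.sum fun β x => monomial D.base β x) =
      Finsupp.linearCombination (RatField k m) (fun β => monomial D.base β 1) a := by
    rw [Finsupp.linearCombination_apply]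
    refine Finsupp.sum_congr fun β _ => ?_
    rw [smul_monomial, mul_one]
  rw [telescoper, hsum, ← hty, add_sub_cancel_right]
  exact ht

theorem isLeadingMonomial_telescoper {α : Fin m →₀ ℕ} {a : (Fin m →₀ ℕ) →₀ RatField k m}
    (ha : ∀ β ∈ a.support, GrevlexLT β α) : IsLeadingMonomial (D.telescoper α a) α := by
  classical
  have hcoeff : ∀ β, (D.telescoper α a).coeff β =
      (Finsupp.single α 1 - a : (Fin m →₀ ℕ) →₀ RatField k m) β := by
    intro β
    have h : (a.sum fun β x => monomial D.base β x) = (a : (Fin m →₀ ℕ) →₀ RatField k m) :=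
      Finsupp.sum_single a
    rw [telescoper, h]
    rfl
  have hα : a α = 0 := by
    by_contra h
    exact GrevlexLT.irrefl _ (ha α (Finsupp.mem_support_iff.2 h))
  refine ⟨Finsupp.mem_support_iff.2 ?_, fun β hβ hne => ha β ?_⟩
  · change (D.telescoper α a).coeff α ≠ 0
    rw [hcoeff]
    simp [hα]
  · have h := coeff_ne_zero hβ
    rw [hcoeff, Finsupp.sub_apply, Finsupp.single_eq_of_ne hne, zero_sub, neg_ne_zero] at h
    exact Finsupp.mem_support_iff.2 h

/-! ### Preservation of the invariant -/

theorem skip (hs : Invariant T ρ s) {α : Fin m →₀ ℕ} {l : List (Fin m →₀ ℕ)}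
    (hl : s.toVisit = α :: l) (hred : s.IsReducible α) :
    Invariant T ρ { s with toVisit := l } where
  sorted := by
    have h := hs.sorted
    rw [hl, List.pairwise_cons] at h
    exact h.2
  quotient_lt q hq ν hν h := hs.quotient_lt q hq ν (hl ▸ List.mem_cons_of_mem α hν) h
  zero_mem := by
    have h := hs.zero_mem
    rw [hl, List.mem_cons] at h
    rcases h with h | (rfl | h) | h
    · exact Or.inl h
    · exact Or.inr (Or.inr hred)
    · exact Or.inr (Or.inl h)
    · exact Or.inr (Or.inr h)
  add_single_mem β hβ j := by
    have h := hs.add_single_mem β hβ j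
    rw [hl, List.mem_cons] at h
    rcases h with h | (h | h) | h
    · exact Or.inl h
    · exact Or.inr (Or.inr (h ▸ hred))
    · exact Or.inr (Or.inl h)
    · exact Or.inr (Or.inr h)
  parent ν hν := hs.parent ν (hl ▸ List.mem_cons_of_mem α hν)
  red_eq := hs.red_eq
  standard := hs.standard
  nodup := hs.nodup
  basis_mem := hs.basis_mem
  leading := hs.leading

theorem relation (hs : Invariant T ρ s)
    (hsmul : ∀ (a : RatField k m) p, ρ (a • p) = emb a * ρ p)
    (hker : ∀ p, ρ p = 0 ↔ p ∈ T) {α : Fin m →₀ ℕ} {l : List (Fin m →₀ ℕ)}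
    (hl : s.toVisit = α :: l) (hα : ¬ s.IsReducible α) {a : (Fin m →₀ ℕ) →₀ RatField k m}
    (ha : s.IsRelation (ρ (monomial D.base α 1)) a) :
    Invariant T ρ { s with
      toVisit := l
      basis := s.basis ++ [D.telescoper α a]
      reducible := s.reducible ++ [α] } := by
  set s' : D.State := { s with
    basis := s.basis ++ [D.telescoper α a]
    reducible := s.reducible ++ [α] }
  have hmono : ∀ μ, s.IsReducible μ → s'.IsReducible μ := fun μ ⟨β, hβ, h⟩ =>
    ⟨β, List.mem_append_left _ hβ, h⟩
  obtain ⟨hsupp, hT⟩ := (hs.isRelation_iff hsmul hker α a).1 ha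
  have hαmem : α ∈ s.toVisit := hl ▸ List.mem_cons_self
  have hs' : Invariant T ρ s' :=
    { sorted := hs.sorted.imp fun h hx hy => h (fun h => hx (hmono _ h)) fun h => hy (hmono _ h)
      quotient_lt := fun q hq ν hν h => hs.quotient_lt q hq ν hν fun h' => h (hmono _ h')
      zero_mem := hs.zero_mem.imp_right (Or.imp_right (hmono _))
      add_single_mem := fun β hβ j => (hs.add_single_mem β hβ j).imp_right (Or.imp_right (hmono _))
      parent := hs.parent
      red_eq := hs.red_eq
      standard := hs.standard
      nodup := hs.nodup
      basis_mem := fun g hg => by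
        rcases List.mem_append.1 hg with hg | hg
        · exact hs.basis_mem g hg
        · rw [List.mem_singleton.1 hg]
          exact hT
      leading := fun β hβ => by
        rcases List.mem_append.1 hβ with hβ | hβ
        · obtain ⟨g, hg, h⟩ := hs.leading β hβ
          exact ⟨g, List.mem_append_left _ hg, h⟩
        · rw [List.mem_singleton.1 hβ]
          exact ⟨_, List.mem_append_right _ (List.mem_singleton_self _),
            isLeadingMonomial_telescoper fun β hβ => hs.quotient_lt β (hsupp β hβ) α hαmem hα⟩ }
  exact hs'.skip hl ⟨α, List.mem_append_right _ (List.mem_singleton_self _), le_rfl⟩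

theorem mem_appendMultiples {l : List (Fin m →₀ ℕ)} {α μ : Fin m →₀ ℕ} :
    μ ∈ appendMultiples l α ↔ μ ∈ l ∨ ∃ j, μ = α + Finsupp.single j 1 := by
  classical
  simp only [appendMultiples, List.mem_append, List.mem_filter, List.mem_map, List.mem_finRange,
    true_and, decide_eq_true_eq]
  constructor
  · rintro (h | ⟨⟨j, rfl⟩, -⟩)
    · exact Or.inl h
    · exact Or.inr ⟨j, rfl⟩
  · rintro (h | ⟨j, rfl⟩)
    · exact Or.inl h
    · by_cases h : α + Finsupp.single j 1 ∈ l
      · exact Or.inl h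
      · exact Or.inr ⟨⟨j, rfl⟩, h⟩

theorem length_appendMultiples_le (l : List (Fin m →₀ ℕ)) (α : Fin m →₀ ℕ) :
    (appendMultiples l α).length ≤ l.length + m := by
  rw [appendMultiples, List.length_append]
  refine Nat.add_le_add_left ((List.length_filter_le _ _).trans ?_) _
  simp

/-- If `∂_j ∂^α` is not yet in `𝓛` when `∂^α` is added to `𝓠`, then it comes after all monomials
of `𝓛`, apart from the multiples of elements of `𝓡`. -/
theorem lt_add_single (hs : Invariant T ρ s) {α : Fin m →₀ ℕ} {l : List (Fin m →₀ ℕ)}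
    (hl : s.toVisit = α :: l) (hα : ¬ s.IsReducible α) {j : Fin m}
    (hj : α + Finsupp.single j 1 ∉ l) (hred : ¬ s.IsReducible (α + Finsupp.single j 1))
    {ν : Fin m →₀ ℕ} (hν : ν ∈ l) (hνred : ¬ s.IsReducible ν) :
    GrevlexLT ν (α + Finsupp.single j 1) := by
  have hαmem : α ∈ s.toVisit := hl ▸ List.mem_cons_self
  have hνmem : ν ∈ s.toVisit := hl ▸ List.mem_cons_of_mem α hν
  have hαν : GrevlexLT α ν := by
    have h := hs.sorted
    rw [hl, List.pairwise_cons] at h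
    exact h.1 ν hν hα hνred
  -- otherwise `∂_j ∂^α` would be in `𝓛` already, as a multiple of a smaller monomial of `𝓠`
  have hsupp : ∀ t, j < t → α t = 0 := by
    intro t ht
    by_contra hne
    obtain ⟨β, hβ, heq⟩ := exists_grevlexLT_add_single_eq ht hne
    have hβred : ¬ s.IsReducible β := fun h => hred (h.of_le (heq ▸ le_self_add))
    have hβQ := (hs.mem_or_isReducible_of_lt hl hα hβ).resolve_right hβred
    have h := hs.add_single_mem β hβQ t
    rw [← heq, hl, List.mem_cons] at h
    rcases h with h | (h | h) | h
    · exact (hs.quotient_lt _ h α hαmem hα).asymm (grevlexLT_add_single α j)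
    · exact (grevlexLT_add_single α j).ne h.symm
    · exact hj h
    · exact hred h
  have hν0 : ν ≠ 0 := by
    rintro rfl
    exact not_grevlexLT_zero _ hαν
  obtain ⟨β, hβ, i, rfl⟩ := (hs.parent ν hνmem).resolve_left hν0
  have hβα := hs.quotient_lt β hβ α hαmem hα
  rcases hβα.degree_le.eq_or_lt with h | h
  · exact hβα.add_single_of_support_le h i j hsupp
  · exact Or.inl (by simpa using h)

theorem independent (hs : Invariant T ρ s)
    (hsmul : ∀ (a : RatField k m) p, ρ (a • p) = emb a * ρ p)
    (hker : ∀ p, ρ p = 0 ↔ p ∈ T) {α : Fin m →₀ ℕ} {l : List (Fin m →₀ ℕ)}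
    (hl : s.toVisit = α :: l) (hα : ¬ s.IsReducible α)
    (ha : ¬ ∃ a, s.IsRelation (ρ (monomial D.base α 1)) a) :
    Invariant T ρ { s with
      toVisit := appendMultiples l α
      quotient := s.quotient ++ [α]
      red := Function.update s.red α (ρ (monomial D.base α 1)) } := by
  classical
  have hαmem : α ∈ s.toVisit := hl ▸ List.mem_cons_self
  have hαQ : ∀ q ∈ s.quotient, GrevlexLT q α := fun q hq => hs.quotient_lt q hq α hαmem hα
  have hsort := hs.sorted
  rw [hl, List.pairwise_cons] at hsort
  have hαself : α ∈ s.quotient ++ [α] := List.mem_append_right _ (List.mem_singleton_self _)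
  have hlmem : ∀ {ν}, ν ∈ l → ν ∈ s.toVisit := fun hν => hl ▸ List.mem_cons_of_mem α hν
  exact
    { sorted := by
        change List.Pairwise (fun x y => ¬ s.IsReducible x → ¬ s.IsReducible y → GrevlexLT x y)
          (appendMultiples l α)
        rw [appendMultiples, List.pairwise_append]
        refine ⟨hsort.2, List.Pairwise.filter _ ?_, fun ν hν μ hμ h h' => ?_⟩
        · rw [List.pairwise_map]
          exact (List.pairwise_lt_finRange m).imp fun h _ _ => grevlexLT_add_single_of_lt α h
        · obtain ⟨hμ, hμl⟩ := List.mem_filter.1 hμ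
          obtain ⟨j, -, rfl⟩ := List.mem_map.1 hμ
          exact hs.lt_add_single hl hα (by simpa using hμl) h' hν h
      quotient_lt := fun q hq ν hν hred => by
        have hαν : GrevlexLT α ν := by
          rcases mem_appendMultiples.1 hν with hν | ⟨j, rfl⟩
          · exact hsort.1 ν hν hα hred
          · exact grevlexLT_add_single α j
        rcases List.mem_append.1 hq with hq | hq
        · exact (hαQ q hq).trans hαν
        · rw [List.mem_singleton.1 hq]
          exact hαν
      zero_mem := by
        have h := hs.zero_mem
        rw [hl, List.mem_cons] at h
        rcases h with h | (h | h) | h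
        · exact Or.inl (List.mem_append_left _ h)
        · exact Or.inl (h ▸ hαself)
        · exact Or.inr (Or.inl (mem_appendMultiples.2 (Or.inl h)))
        · exact Or.inr (Or.inr h)
      add_single_mem := fun β hβ j => by
        rcases List.mem_append.1 hβ with hβ | hβ
        · have h := hs.add_single_mem β hβ j
          rw [hl, List.mem_cons] at h
          rcases h with h | (h | h) | h
          · exact Or.inl (List.mem_append_left _ h)
          · exact Or.inl (h ▸ hαself)
          · exact Or.inr (Or.inl (mem_appendMultiples.2 (Or.inl h)))
          · exact Or.inr (Or.inr h)
        · rw [List.mem_singleton.1 hβ]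
          exact Or.inr (Or.inl (mem_appendMultiples.2 (Or.inr ⟨j, rfl⟩)))
      parent := fun ν hν => by
        rcases mem_appendMultiples.1 hν with hν | ⟨j, rfl⟩
        · exact (hs.parent ν (hlmem hν)).imp_right fun ⟨β, hβ, h⟩ =>
            ⟨β, List.mem_append_left _ hβ, h⟩
        · exact Or.inr ⟨α, hαself, j, rfl⟩
      red_eq := fun β hβ => by
        rcases List.mem_append.1 hβ with hβ | hβ
        · exact (Function.update_of_ne (hαQ β hβ).ne _ _).trans (hs.red_eq β hβ)
        · rw [List.mem_singleton.1 hβ]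
          exact Function.update_self _ _ _
      standard := fun β hβ => by
        rcases List.mem_append.1 hβ with hβ | hβ
        · exact hs.standard β hβ
        · rw [List.mem_singleton.1 hβ]
          exact fun h => ha (hs.exists_isRelation hsmul hker hl hα h)
      nodup := by
        refine List.Nodup.append hs.nodup (List.nodup_singleton α) ?_
        intro q hq hq'
        exact (hαQ q hq).ne (List.mem_singleton.1 hq')
      basis_mem := hs.basis_mem
      leading := hs.leading }

section Step

variable {A₁ : OpS k m} {B : Fin m → OpS k m} {c : RatField k (m + 1) → RatField k (m + 1)}

theorem step (hsmul : ∀ (a : RatField k m) p, ρ (a • p) = emb a * ρ p)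
    (hker : ∀ p, ρ p = 0 ↔ p ∈ T) (h1 : ρ 1 = c (OpS.adjoint A₁ 1))
    (hvar : ∀ j p, ρ (var D.base j * p) = c (D.phi B j (ρ p)))
    (hs : Invariant T ρ s) {t : D.State} (hst : Step A₁ B c s t) : Invariant T ρ t := by
  cases hst with
  | skip α l hl hred => exact hs.skip hl hred
  | relation α l R a hl hred hR ha =>
    rw [hs.eq_of_computes h1 hvar hR] at ha
    exact hs.relation hsmul hker hl hred ha
  | independent α l R hl hred hR ha =>
    rw [hs.eq_of_computes h1 hvar hR] at ha ⊢
    exact hs.independent hsmul hker hl hred ha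

theorem of_reachable (hsmul : ∀ (a : RatField k m) p, ρ (a • p) = emb a * ρ p)
    (hker : ∀ p, ρ p = 0 ↔ p ∈ T) (h1 : ρ 1 = c (OpS.adjoint A₁ 1))
    (hvar : ∀ j p, ρ (var D.base j * p) = c (D.phi B j (ρ p)))
    (hs : D.Reachable A₁ B c s) : Invariant T ρ s := by
  induction hs with
  | refl => exact invariant_initial
  | tail _ hst ih => exact ih.step hsmul hker h1 hvar hst

theorem exists_step (hs : Invariant T ρ s) (hne : s.toVisit ≠ []) : ∃ t, Step A₁ B c s t := by
  obtain ⟨α, l, hl⟩ := List.exists_cons_of_ne_nil hne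
  by_cases hred : s.IsReducible α
  · exact ⟨_, Step.skip s α l hl hred⟩
  · obtain ⟨R, hR⟩ := hs.exists_computes A₁ B c (hl ▸ List.mem_cons_self : α ∈ s.toVisit)
    by_cases ha : ∃ a, s.IsRelation R a
    · obtain ⟨a, ha⟩ := ha
      exact ⟨_, Step.relation s α l R a hl hred hR ha⟩
    · exact ⟨_, Step.independent s α l R hl hred hR ha⟩

/-! ### Termination and output -/

/-- Each pass shortens `𝓛` by one, except that adding an element to `𝓠`, which happens at most `N`
times when `N` bounds the length of `𝓠`, may lengthen `𝓛` by up to `m - 1`. -/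
theorem measure_lt {N : ℕ} {t : D.State} (hst : Step A₁ B c s t) (hN : t.quotient.length ≤ N) :
    (N - t.quotient.length) * (m + 1) + t.toVisit.length <
      (N - s.quotient.length) * (m + 1) + s.toVisit.length := by
  cases hst with
  | skip α l hl hred => simp [hl]
  | relation α l R a hl hred hR ha => simp [hl]
  | independent α l R hl hred hR ha =>
    have h := length_appendMultiples_le l α
    simp only [List.length_append, List.length_singleton] at hN ⊢
    have hsucc : N - s.quotient.length = N - (s.quotient.length + 1) + 1 := by omega
    rw [hsucc, add_mul, one_mul, hl, List.length_cons]
    omega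

end Step

/-- At the end, every monomial is in `𝓠` or is a multiple of an element of `𝓡`. -/
theorem mem_or_isReducible_of_toVisit_eq_nil (hs : Invariant T ρ s) (hnil : s.toVisit = [])
    (μ : Fin m →₀ ℕ) : μ ∈ s.quotient ∨ s.IsReducible μ := by
  refine or_iff_not_imp_right.2 fun hred => (hs.mem_or_exists_le μ hred).resolve_right ?_
  rintro ⟨ν, hν, -⟩
  rw [hnil] at hν
  exact List.not_mem_nil hν

theorem isDFinite_of_toVisit_eq_nil (hs : Invariant T ρ s) (hnil : s.toVisit = []) :
    IsDFinite T :=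
  isDFinite_of_finite (Q := {q | q ∈ s.quotient}) (List.finite_toSet _) fun μ =>
    (hs.mem_or_isReducible_of_toVisit_eq_nil hnil μ).imp_right hs.isLeadingExponent_of_isReducible

theorem isGroebnerBasis_of_toVisit_eq_nil (hs : Invariant T ρ s) (hnil : s.toVisit = []) :
    IsGroebnerBasis {g | g ∈ s.basis} T := by
  refine ⟨List.finite_toSet _, fun g hg => hs.basis_mem g hg, fun f hf hf0 => ?_⟩
  obtain ⟨β, hβ⟩ := exists_isLeadingMonomial hf0
  obtain ⟨α, hα, hle⟩ := (hs.mem_or_isReducible_of_toVisit_eq_nil hnil β).resolve_left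
    fun h => hs.standard β h (hβ.isLeadingExponent hf)
  obtain ⟨g, hg, hlead⟩ := hs.leading α hα
  exact ⟨g, hg, α, β, hlead, hβ, hle⟩

end Invariant

end Algorithm

end Setting

end CreativeTelescoping

end

open CreativeTelescoping CreativeTelescoping.Setting in
theorem mainTheorem2 {k : Type*} [Field k] [CharZero k] {m : ℕ} (D : Setting k m)
    (gens : Finset D.A) (I : Submodule D.A D.A) (hgens : I = Submodule.span D.A (gens : Set D.A))
    (hI : IsDFinite I)
    (γ : D.A ⧸ I) (hγ : D.IsCyclicVector γ)
    (L : OpS k m) (hL : D.IsMinimalAnnihilator γ L)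
    (A₁ : OpS k m) (hA₁ : D.ofOpS A₁ • γ = Submodule.Quotient.mk 1)
    (B : Fin m → OpS k m) (hB : ∀ i, OreAlgebra.var D.total i.succ • γ = D.ofOpS (B i) • γ)
    (c : RatField k (m + 1) → RatField k (m + 1)) (hc : IsCanonicalForm L c) :
    (D.Terminates A₁ B c ↔ IsDFinite (D.telescopingIdeal I)) ∧
      ((∃ G, D.Outputs A₁ B c G) ↔ IsDFinite (D.telescopingIdeal I)) ∧
      ∀ G, D.Outputs A₁ B c G → IsGroebnerBasis {g | g ∈ G} (D.telescopingIdeal I) := by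
  obtain ⟨ρ, hsmul, hker, h1, hvar⟩ := exists_normalForm hγ hL hA₁ hB hc
  have hinv : ∀ s, D.Reachable A₁ B c s → Invariant (D.telescopingIdeal I) ρ s :=
    fun s hs => Invariant.of_reachable hsmul hker h1 hvar hs
  have hprogress : ∀ s, D.Reachable A₁ B c s → s.toVisit ≠ [] → ∃ t, Step A₁ B c s t :=
    fun s hs hne => (hinv s hs).exists_step hne
  have hreach : ∀ f : ℕ → D.State, f 0 = D.initial → (∀ i, Step A₁ B c (f i) (f (i + 1))) →
      ∀ i, D.Reachable A₁ B c (f i) := by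
    intro f h0 hf i
    induction i with
    | zero => rw [h0]; exact Relation.ReflTransGen.refl
    | succ i ih => exact ih.tail (hf i)
  have hterm : IsDFinite (D.telescopingIdeal I) → D.Terminates A₁ B c := by
    refine fun hfin => ⟨?_, hprogress⟩
    rintro ⟨f, h0, hf⟩
    refine (wellFounded_iff_isEmpty_descending_chain.1 (wellFounded_lt (α := ℕ))).false
      ⟨fun i => (Module.finrank (RatField k m) (D.A' ⧸ D.telescopingIdeal I) -
        (f i).quotient.length) * (m + 1) + (f i).toVisit.length,
        fun i => Invariant.measure_lt (hf i) ?_⟩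
    have h := hinv _ (hreach f h0 hf (i + 1))
    exact length_le_finrank hfin _ h.nodup h.standard
  have hout : D.Terminates A₁ B c → ∃ G, D.Outputs A₁ B c G := by
    rintro ⟨hinf, -⟩
    by_contra hno
    -- without a final state every run can be continued forever
    have hne : ∀ s : {s // D.Reachable A₁ B c s}, ∃ t, Step A₁ B c s.1 t := fun s =>
      hprogress s.1 s.2 fun hnil => hno ⟨_, s.1, s.2, hnil, rfl⟩
    choose next hnext using hne
    let f : ℕ → {s // D.Reachable A₁ B c s} := fun i =>
      Nat.rec ⟨D.initial, Relation.ReflTransGen.refl⟩ (fun _ s => ⟨next s, s.2.tail (hnext s)⟩) i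
    exact hinf ⟨fun i => (f i).1, rfl, fun i => hnext (f i)⟩
  have hdfin : (∃ G, D.Outputs A₁ B c G) → IsDFinite (D.telescopingIdeal I) := by
    rintro ⟨G, s, hs, hnil, -⟩
    exact (hinv s hs).isDFinite_of_toVisit_eq_nil hnil
  refine ⟨⟨fun h => hdfin (hout h), hterm⟩, ⟨hdfin, fun h => hout (hterm h)⟩, ?_⟩
  rintro G ⟨s, hs, hnil, rfl⟩
  exact (hinv s hs).isGroebnerBasis_of_toVisit_eq_nil hnil
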